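/- **Theorem (Extended Computable Open Mapping Theorem).** Let $\hat{\mathbb C}=\mathbb C\cup\{\infty\}$ be the Riemann sphere. Call a subset of $\hat{\mathbb C}$ *basic* if it is an open rectangle $(a,b)\times(c,d)\subseteq\mathbb C$ with rational $a<b$, $c<d$, or the set $\hat{\mathbb C}\setminus\overline{D_r(0)}$ for a rational $r>0$, where $D_r(0)$ is the open disk of radius $r$ about $0$; basic sets are coded by natural numbers in a standard effective way, and a *list* of basic sets is an infinite sequence of such codes and blanks (the list may be empty, and the order is arbitrary). Names are defined as follows. * A *name* of a point $z\in\hat{\mathbb C}$ is a list of all basic sets that contain $z$. * A *name* of an open set $U\subseteq\hat{\mathbb C}$ is a list of all basic sets whose closures (in $\hat{\mathbb C}$) are contained in $U$. * A *name* of a function $f:D\to\hat{\mathbb C}$ with $D\subseteq\hat{\mathbb C}$ is a pair $(X,e)$ of a set $X\subseteq\mathbb N$ and a code $e$ of an oracle machine with one-way output tape which, given access to the oracle $X$, and given any name of any point $z\in D$ as input, writes a name of $f(z)$ on its output tape. (The name carries no further information about $D$.) Let a function $f:D\to\hat{\mathbb C}$ on an open set $D\subseteq\hat{\mathbb C}$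 be called *non-constant meromorphic* if it is meromorphic in the usual sense (with value $\infty$ at its poles; at the point $\infty$ with respect to the coordinate $1/z$), and non-constant; if $D$ is not connected, this means non-constant on every connected component of $D$. Then there is a single machine $M$ with one-way output tape such that the following holds for every open $D\subseteq\hat{\mathbb C}$, every non-constant meromorphic $f:D\to\hat{\mathbb C}$ and every open $U\subseteq D$: the image $f[U]$ is an open subset of $\hat{\mathbb C}$, and whenever $M$ is given any name $(X,e)$ of $f$ and any name of $U$ as input, it writes a name of $f[U]$ on its output tape. -/

import Mathlib

/-! ### Oracle machines -/

/-- Codes of oracle machines: Mathlib's codes `Nat.Partrec.Code` of partial recursive functions with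
one more instruction, `oracle`, which queries the oracle (equivalently, reads a cell of the infinite
input tape). -/
inductive OracleCode : Type
  | zero : OracleCode
  | succ : OracleCode
  | left : OracleCode
  | right : OracleCode
  | oracle : OracleCode
  | pair : OracleCode → OracleCode → OracleCode
  | comp : OracleCode → OracleCode → OracleCode
  | prec : OracleCode → OracleCode → OracleCode
  | rfind' : OracleCode → OracleCode

namespace OracleCode

/-- The partial function computed by a code when the oracle is `A : ℕ → ℕ`. The clauses are those of
`Nat.Partrec.Code.eval`; `oracle` computes `A` itself. -/
def eval (A : ℕ → ℕ) : OracleCode → ℕ →. ℕ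
  | zero => pure 0
  | succ => Nat.succ
  | left => ↑fun n : ℕ => n.unpair.1
  | right => ↑fun n : ℕ => n.unpair.2
  | oracle => A
  | pair cf cg => fun n => Nat.pair <$> eval A cf n <*> eval A cg n
  | comp cf cg => fun n => eval A cg n >>= eval A cf
  | prec cf cg =>
    Nat.unpaired fun a n =>
      n.rec (eval A cf a) fun y IH => do
        let i ← IH
        eval A cg (Nat.pair a (Nat.pair y i))
  | rfind' cf =>
    Nat.unpaired fun a m =>
      (Nat.rfind fun n => (fun k => k = 0) <$> eval A cf (Nat.pair a (n + m))).map (· + m)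

/-- The numbering of codes (each code is given to other machines as this number). -/
def toNat : OracleCode → ℕ
  | zero => 0
  | succ => 1
  | left => 2
  | right => 3
  | oracle => 4
  | pair cf cg => 4 * Nat.pair (toNat cf) (toNat cg) + 5
  | comp cf cg => 4 * Nat.pair (toNat cf) (toNat cg) + 6
  | prec cf cg => 4 * Nat.pair (toNat cf) (toNat cg) + 7
  | rfind' cf => 4 * toNat cf + 8

theorem toNat_injective : Function.Injective toNat := by
  intro c
  induction c with
  | zero | succ | left | right | oracle =>
    intro d h; cases d <;> simp only [toNat] at h <;> first | rfl | omega
  | pair a b iha ihb | comp a b iha ihb | prec a b iha ihb =>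
    intro d h
    cases d <;> simp only [toNat] at h <;> try omega
    rename_i a' b'
    have h' : Nat.pair a.toNat b.toNat = Nat.pair a'.toNat b'.toNat := by omega
    rw [iha (Nat.pair_eq_pair.1 h').1, ihb (Nat.pair_eq_pair.1 h').2]
  | rfind' a iha =>
    intro d h
    cases d <;> simp only [toNat] at h <;> try omega
    rename_i a'
    have h' : a.toNat = a'.toNat := by omega
    rw [iha h']

/-- The codes compute exactly the functions that are recursive in the oracle in Mathlib's sense. -/
theorem exists_eval_eq_iff (A : ℕ → ℕ) (g : ℕ →. ℕ) :
    (∃ c : OracleCode, c.eval A = g) ↔ Nat.RecursiveIn {(A : ℕ →. ℕ)} g := by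
  constructor
  · rintro ⟨c, rfl⟩
    induction c with
    | zero => exact .zero
    | succ => exact .succ
    | left => exact .left
    | right => exact .right
    | oracle => exact .oracle _ rfl
    | pair a b iha ihb => exact .pair iha ihb
    | comp a b iha ihb => exact .comp iha ihb
    | prec a b iha ihb => exact .prec iha ihb
    | rfind' a iha =>
      have h1 : Nat.RecursiveIn {(A : ℕ →. ℕ)}
          (fun p => ((Nat.pair p.unpair.1.unpair.1
            (p.unpair.2 + p.unpair.1.unpair.2) : ℕ) : Part ℕ)) := by
        refine Nat.Partrec.recursiveIn (Nat.Partrec.of_primrec ?_)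
        refine Nat.Primrec.pair (Nat.Primrec.left.comp Nat.Primrec.left) ?_
        exact (Nat.Primrec.add.comp (Nat.Primrec.right.pair
          (Nat.Primrec.right.comp Nat.Primrec.left))).of_eq (by simp [Nat.unpaired])
      have h2 := (iha.comp h1).rfind
      have h3 : Nat.RecursiveIn {(A : ℕ →. ℕ)}
          (fun p => ((p.unpair.1 + p.unpair.2 : ℕ) : Part ℕ)) :=
        Nat.Partrec.recursiveIn (Nat.Partrec.of_primrec Nat.Primrec.add)
      refine (h3.comp (h2.pair .right)).of_eq fun n => ?_
      simp [eval, Nat.unpaired, Seq.seq, Part.map_eq_map, Part.bind_some_eq_map, Part.map_map,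
        Function.comp_def]
      congr 2
      funext k
      congr 1
      exact Part.bind_some _ _
  · intro h
    induction h with
    | zero => exact ⟨zero, rfl⟩
    | succ => exact ⟨succ, rfl⟩
    | left => exact ⟨left, rfl⟩
    | right => exact ⟨right, rfl⟩
    | oracle g hg => exact ⟨oracle, (Set.mem_singleton_iff.1 hg).symm⟩
    | pair _ _ iha ihb =>
      obtain ⟨a, rfl⟩ := iha; obtain ⟨b, rfl⟩ := ihb; exact ⟨pair a b, rfl⟩
    | comp _ _ iha ihb =>
      obtain ⟨a, rfl⟩ := iha; obtain ⟨b, rfl⟩ := ihb; exact ⟨comp a b, rfl⟩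
    | prec _ _ iha ihb =>
      obtain ⟨a, rfl⟩ := iha; obtain ⟨b, rfl⟩ := ihb; exact ⟨prec a b, rfl⟩
    | rfind _ iha =>
      obtain ⟨a, rfl⟩ := iha
      refine ⟨comp (rfind' a) (pair (pair left right) zero), ?_⟩
      funext n
      simp [eval, Nat.unpaired, Seq.seq, pure, PFun.pure, Part.map_id']

/-- With the sequence `A` on its input tape, the machine writes the sequence `q` on its one-way
output tape: the `n`-th output symbol is the value at `n`. -/
def Computes (c : OracleCode) (A q : ℕ → ℕ) : Prop :=
  ∀ n, q n ∈ c.eval A n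

end OracleCode

/-- Two sequences written on one tape: the first in the even cells, the second in the odd cells. -/
def tapeJoin (p q : ℕ → ℕ) (n : ℕ) : ℕ :=
  if n % 2 = 0 then p (n / 2) else q (n / 2)

/-! ### The Riemann sphere and its basic open sets -/

/-- The extended complex plane, with the topology of the one-point compactification. -/
abbrev RiemannSphere : Type := OnePoint ℂ

/-- The open rectangle `(a, b) × (c, d)`, as a subset of the sphere. -/
def openRect (a b c d : ℚ) : Set RiemannSphere :=
  (fun z : ℂ => (z : RiemannSphere)) ''
    {z | (a : ℝ) < z.re ∧ z.re < b ∧ (c : ℝ) < z.im ∧ z.im < d}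

/-- The complement in the sphere of the closed disk of radius `r` about `0`. -/
def diskExterior (r : ℚ) : Set RiemannSphere :=
  ((fun z : ℂ => (z : RiemannSphere)) '' Metric.closedBall 0 (r : ℝ))ᶜ

/-- The basic open sets: rational rectangles, and complements of closed disks about `0` of rational
radius. -/
def IsBasic (S : Set RiemannSphere) : Prop :=
  (∃ a b c d : ℚ, a < b ∧ c < d ∧ S = openRect a b c d) ∨ ∃ r : ℚ, 0 < r ∧ S = diskExterior r

/-- A numbering of the rationals. -/
def ratOfNat (n : ℕ) : ℚ :=
  ((n.unpair.1.unpair.1 : ℚ) - n.unpair.1.unpair.2) / (n.unpair.2 + 1)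

/-- A numbering of the positive rationals. -/
def posRatOfNat (n : ℕ) : ℚ :=
  ((n.unpair.1 : ℚ) + 1) / (n.unpair.2 + 1)

/-- The rectangle with the number `n`; lower left corner and side lengths are coded. -/
def rectOfNat (n : ℕ) : Set RiemannSphere :=
  let a := ratOfNat n.unpair.1.unpair.1
  let c := ratOfNat n.unpair.2.unpair.1
  openRect a (a + posRatOfNat n.unpair.1.unpair.2) c (c + posRatOfNat n.unpair.2.unpair.2)

/-- The numbering of the basic open sets. -/
def basicOfNat (n : ℕ) : Set RiemannSphere :=
  if n % 2 = 0 then rectOfNat (n / 2) else diskExterior (posRatOfNat (n / 2))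

theorem posRatOfNat_pos (n : ℕ) : 0 < posRatOfNat n := by
  unfold posRatOfNat; positivity

theorem exists_posRatOfNat (r : ℚ) (hr : 0 < r) : ∃ n, posRatOfNat n = r := by
  refine ⟨Nat.pair (r.num.toNat - 1) (r.den - 1), ?_⟩
  have h1 : 0 < r.num := Rat.num_pos.2 hr
  have h2 : 0 < r.den := r.den_pos
  have h3 : ((r.num.toNat - 1 : ℕ) : ℚ) + 1 = (r.num : ℚ) := by
    have : ((r.num.toNat - 1 : ℕ) : ℤ) + 1 = r.num := by omega
    exact_mod_cast this
  have h4 : ((r.den - 1 : ℕ) : ℚ) + 1 = (r.den : ℚ) := by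
    have : (r.den - 1 : ℕ) + 1 = r.den := by omega
    exact_mod_cast this
  simp only [posRatOfNat, Nat.unpair_pair]
  rw [h3, h4, Rat.num_div_den]

theorem exists_ratOfNat (r : ℚ) : ∃ n, ratOfNat n = r := by
  refine ⟨Nat.pair (Nat.pair r.num.toNat (-r.num).toNat) (r.den - 1), ?_⟩
  have h2 : 0 < r.den := r.den_pos
  have h3 : ((r.num.toNat : ℕ) : ℚ) - ((-r.num).toNat : ℕ) = (r.num : ℚ) := by
    have : ((r.num.toNat : ℕ) : ℤ) - ((-r.num).toNat : ℕ) = r.num := by omega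
    exact_mod_cast this
  have h4 : ((r.den - 1 : ℕ) : ℚ) + 1 = (r.den : ℚ) := by
    have : (r.den - 1 : ℕ) + 1 = r.den := by omega
    exact_mod_cast this
  simp only [ratOfNat, Nat.unpair_pair]
  rw [h3, h4, Rat.num_div_den]

/-- The numbering reaches exactly the basic open sets. -/
theorem range_basicOfNat : Set.range basicOfNat = {S | IsBasic S} := by
  ext S
  constructor
  · rintro ⟨n, rfl⟩
    unfold basicOfNat
    split_ifs
    · exact Or.inl ⟨_, _, _, _, lt_add_of_pos_right _ (posRatOfNat_pos _),
        lt_add_of_pos_right _ (posRatOfNat_pos _), rfl⟩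
    · exact Or.inr ⟨_, posRatOfNat_pos _, rfl⟩
  · rintro (⟨a, b, c, d, hab, hcd, rfl⟩ | ⟨r, hr, rfl⟩)
    · obtain ⟨i, hi⟩ := exists_ratOfNat a
      obtain ⟨j, hj⟩ := exists_posRatOfNat (b - a) (sub_pos.2 hab)
      obtain ⟨k, hk⟩ := exists_ratOfNat c
      obtain ⟨l, hl⟩ := exists_posRatOfNat (d - c) (sub_pos.2 hcd)
      refine ⟨2 * Nat.pair (Nat.pair i j) (Nat.pair k l), ?_⟩
      simp [basicOfNat, rectOfNat, hi, hj, hk, hl]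
    · obtain ⟨n, hn⟩ := exists_posRatOfNat r hr
      refine ⟨2 * n + 1, ?_⟩
      have h : (2 * n + 1) / 2 = n := by omega
      simp [basicOfNat, h, hn, Nat.add_mod]

/-! ### Names -/

/-- The family of basic open sets listed by a sequence. The entry `0` is a blank, which lists
nothing (so that the empty family can be listed too); the entry `k + 1` lists the basic set with the
number `k`. -/
def listedSets (p : ℕ → ℕ) : Set (Set RiemannSphere) :=
  {S | ∃ n k, p n = k + 1 ∧ basicOfNat k = S}

/-- `p` is a name of the point `z`: a list of all basic open sets that contain `z`. -/
def IsPointName (p : ℕ → ℕ) (z : RiemannSphere) : Prop :=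
  listedSets p = {S | IsBasic S ∧ z ∈ S}

/-- `p` is a name of the open set `U`: a list of all basic open sets whose closures are contained
in `U`. -/
def IsOpenName (p : ℕ → ℕ) (U : Set RiemannSphere) : Prop :=
  listedSets p = {S | IsBasic S ∧ closure S ⊆ U}

/-- The characteristic function of a set of natural numbers. -/
noncomputable def charSeq (X : Set ℕ) : ℕ → ℕ :=
  X.indicator fun _ => 1

/-- The pair `(X, e)` is a name of the function `f` with domain `D`: with the oracle `X`, the machine
with the code `e` turns every name of every point `z` of `D` into a name of `f z`. The input tape
and the oracle are both available to the machine through `tapeJoin`. -/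
def IsFunctionName (X : Set ℕ) (e : OracleCode) (f : RiemannSphere → RiemannSphere)
    (D : Set RiemannSphere) : Prop :=
  ∀ z ∈ D, ∀ p, IsPointName p z →
    ∃ q, e.Computes (tapeJoin p (charSeq X)) q ∧ IsPointName q (f z)

/-- The pair `(X, e)` written as one sequence: first the number of the code `e`, then the
characteristic function of `X`. -/
noncomputable def functionNameSeq (X : Set ℕ) (e : OracleCode) : ℕ → ℕ
  | 0 => e.toNat
  | n + 1 => charSeq X n

/-! ### Meromorphic functions on open subsets of the sphere -/

/-- The complex number underlying a finite point of the sphere (`0` at `∞`). -/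
noncomputable def finitePart : RiemannSphere → ℂ
  | none => 0
  | some z => z

/-- The coordinate at infinity: `w ↦ 1 / w`, with `0 ↦ ∞`. -/
noncomputable def infinityChart (w : ℂ) : RiemannSphere :=
  open Classical in if w = 0 then OnePoint.infty else ((w⁻¹ : ℂ) : RiemannSphere)

/-- `f` is a meromorphic function with domain `D`, an open subset of the sphere: it is meromorphic in
the coordinate `z` at the finite points of `D` and in the coordinate `1 / z` at `∞`, and its values
(`∞` at the poles) are those that make it continuous as a map into the sphere. -/
structure IsMeromorphicOn (f : RiemannSphere → RiemannSphere) (D : Set RiemannSphere) : Prop where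
  isOpen_domain : IsOpen D
  continuousOn : ContinuousOn f D
  meromorphicAt_finite : ∀ z : ℂ, (z : RiemannSphere) ∈ D →
    MeromorphicAt (fun w : ℂ => finitePart (f (w : RiemannSphere))) z
  meromorphicAt_infty : OnePoint.infty ∈ D →
    MeromorphicAt (fun w : ℂ => finitePart (f (infinityChart w))) 0

/-- `f` is non-constant on `D`, where for a disconnected `D` this means: on every connected component
of `D`. -/
def IsNonconstantOn (f : RiemannSphere → RiemannSphere) (D : Set RiemannSphere) : Prop :=
  ∀ x ∈ D, ∃ y ∈ connectedComponentIn D x, f y ≠ f x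

/-!
For a basic set `B` with closure in `U`, a basic set `V` that meets `f '' B` and is disjoint from
`f '' frontier B` is contained in `f '' B`: inside the connected set `V`, the open set `f '' B` is
also closed. Around every `f z` such a `V` exists, because a small `B` around `z` contains no other
point of the fibre of `z` in its closure. Hence `f '' U` is the union of the basic sets with such a
certificate. That a compact set is covered by basic sets with a given semidecidable property can be
confirmed on a sufficiently fine finite grid of the sphere, and a run of the machine that evaluates
`f` reads only finitely many basic sets around its argument, so that it is valid for all points of a
basic set. The certificates are therefore semidecidable, uniformly in the given names.
-/

/-! ### Inclusion and disjointness of basic sets -/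

section AbsOnInterval

variable {K : Type*} [AddCommGroup K] [LinearOrder K] {a b : K}

/-- The minimum of `|x|` over `x ∈ [a, b]`. -/
def minAbs (a b : K) : K := max 0 (max a (-b))

/-- The maximum of `|x|` over `x ∈ [a, b]`. -/
def maxAbs (a b : K) : K := max (-a) b

variable [IsOrderedAddMonoid K]

theorem isLeast_abs_image_Icc (h : a ≤ b) : IsLeast ((|·|) '' Set.Icc a b) (minAbs a b) := by
  constructor
  · rcases le_total 0 a with ha | ha
    · exact ⟨a, ⟨le_rfl, h⟩, by grind [minAbs]⟩
    rcases le_total b 0 with hb | hb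
    · exact ⟨b, ⟨h, le_rfl⟩, by grind [minAbs]⟩
    · exact ⟨0, ⟨ha, hb⟩, by grind [minAbs]⟩
  · rintro _ ⟨x, ⟨hax, hxb⟩, rfl⟩
    exact max_le (abs_nonneg x) (max_le (hax.trans (le_abs_self x))
      ((neg_le_neg hxb).trans (neg_le_abs x)))

theorem isGreatest_abs_image_Icc (h : a ≤ b) :
    IsGreatest ((|·|) '' Set.Icc a b) (maxAbs a b) := by
  constructor
  · rcases le_total (-a) b with hab | hab
    · exact ⟨b, ⟨h, le_rfl⟩, by grind [maxAbs]⟩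
    · exact ⟨a, ⟨le_rfl, h⟩, by grind [maxAbs]⟩
  · rintro _ ⟨x, ⟨hax, hxb⟩, rfl⟩
    exact abs_le'.2 ⟨hxb.trans (le_max_right _ _), (neg_le_neg hax).trans (le_max_left _ _)⟩

end AbsOnInterval

theorem disjoint_reProdIm {s t s' t' : Set ℝ} :
    Disjoint (s ×ℂ t) (s' ×ℂ t') ↔ Disjoint s s' ∨ Disjoint t t' := by
  rw [← Set.disjoint_prod, ← Set.disjoint_preimage_iff Complex.equivRealProd.surjective]
  rfl

section NormOnRectangle

variable {a b c d r : ℝ}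

theorem forall_le_norm_reProdIm_Icc_iff (hab : a ≤ b) (hcd : c ≤ d) (hr : 0 ≤ r) :
    (∀ z ∈ Set.Icc a b ×ℂ Set.Icc c d, r ≤ ‖z‖) ↔ r ^ 2 ≤ minAbs a b ^ 2 + minAbs c d ^ 2 := by
  have hsq (z : ℂ) : r ≤ ‖z‖ ↔ r ^ 2 ≤ |z.re| ^ 2 + |z.im| ^ 2 := by
    rw [← sq_le_sq₀ hr (norm_nonneg z), Complex.sq_norm, Complex.normSq_apply, sq_abs, sq_abs,
      sq, sq z.re, sq z.im]
  simp only [hsq]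
  obtain ⟨⟨x, hx, hxmin⟩, hmin⟩ := isLeast_abs_image_Icc hab
  obtain ⟨⟨y, hy, hymin⟩, hmin'⟩ := isLeast_abs_image_Icc hcd
  refine ⟨fun h => by simpa only [← hxmin, ← hymin] using h ⟨x, y⟩ ⟨hx, hy⟩,
    fun h z hz => h.trans ?_⟩
  gcongr
  exacts [le_max_left _ _, hmin ⟨_, hz.1, rfl⟩, le_max_left _ _, hmin' ⟨_, hz.2, rfl⟩]

theorem forall_norm_le_reProdIm_Icc_iff (hab : a ≤ b) (hcd : c ≤ d) (hr : 0 ≤ r) :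
    (∀ z ∈ Set.Icc a b ×ℂ Set.Icc c d, ‖z‖ ≤ r) ↔ maxAbs a b ^ 2 + maxAbs c d ^ 2 ≤ r ^ 2 := by
  have hsq (z : ℂ) : ‖z‖ ≤ r ↔ |z.re| ^ 2 + |z.im| ^ 2 ≤ r ^ 2 := by
    rw [← sq_le_sq₀ (norm_nonneg z) hr, Complex.sq_norm, Complex.normSq_apply, sq_abs, sq_abs,
      sq r, sq z.re, sq z.im]
  simp only [hsq]
  obtain ⟨⟨x, hx, hxmax⟩, hmax⟩ := isGreatest_abs_image_Icc hab
  obtain ⟨⟨y, hy, hymax⟩, hmax'⟩ := isGreatest_abs_image_Icc hcd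
  refine ⟨fun h => by simpa only [← hxmax, ← hymax] using h ⟨x, y⟩ ⟨hx, hy⟩,
    fun h z hz => le_trans ?_ h⟩
  gcongr
  exacts [hmax ⟨_, hz.1, rfl⟩, hmax' ⟨_, hz.2, rfl⟩]

end NormOnRectangle

section BasicSets

variable {a b c d a' b' c' d' r r' : ℚ}

theorem openRect_eq_image : openRect a b c d =
    (↑) '' (Set.Ioo (a : ℝ) b ×ℂ Set.Ioo (c : ℝ) d) := by
  simp only [openRect, Complex.reProdIm, Set.preimage, Set.inter_def, Set.mem_Ioo, and_assoc,
    Set.mem_ofPred_eq]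

theorem infty_notMem_openRect : (OnePoint.infty : RiemannSphere) ∉ openRect a b c d := by
  simp [openRect]

theorem infty_mem_diskExterior : (OnePoint.infty : RiemannSphere) ∈ diskExterior r := by
  simp [diskExterior]

theorem coe_mem_diskExterior {z : ℂ} : (z : RiemannSphere) ∈ diskExterior r ↔ (r : ℝ) < ‖z‖ := by
  simp [diskExterior]

theorem openRect_subset_openRect_iff (hab : a < b) (hcd : c < d) :
    openRect a b c d ⊆ openRect a' b' c' d' ↔ (a' ≤ a ∧ b ≤ b') ∧ c' ≤ c ∧ d ≤ d' := by
  have hab' : (a : ℝ) < b := mod_cast hab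
  have hcd' : (c : ℝ) < d := mod_cast hcd
  rw [openRect_eq_image, openRect_eq_image, Set.image_subset_image_iff OnePoint.coe_injective,
    Complex.reProdIm_subset_iff', Set.Ioo_subset_Ioo_iff hab', Set.Ioo_subset_Ioo_iff hcd']
  simp [Set.Ioo_eq_empty_iff, hab, hcd]

theorem openRect_subset_diskExterior_iff (hab : a < b) (hcd : c < d) (hr : 0 < r) :
    openRect a b c d ⊆ diskExterior r ↔ r ^ 2 ≤ minAbs a b ^ 2 + minAbs c d ^ 2 := by
  have hab' : (a : ℝ) < b := mod_cast hab
  have hcd' : (c : ℝ) < d := mod_cast hcd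
  have hr' : (0 : ℝ) < r := mod_cast hr
  have hopen := (isOpen_Ioo (a := (a : ℝ)) (b := b)).reProdIm (isOpen_Ioo (a := (c : ℝ)) (b := d))
  calc openRect a b c d ⊆ diskExterior r
      ↔ Disjoint (Set.Ioo (a : ℝ) b ×ℂ Set.Ioo (c : ℝ) d) (closure (Metric.ball 0 r)) := by
        rw [openRect_eq_image, diskExterior, Set.subset_compl_iff_disjoint_right,
          Set.disjoint_image_iff OnePoint.coe_injective, closure_ball _ hr'.ne']
    _ ↔ Disjoint (closure (Set.Ioo (a : ℝ) b ×ℂ Set.Ioo (c : ℝ) d)) (Metric.ball 0 r) :=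
        ⟨fun h => (h.mono_right subset_closure).closure_left Metric.isOpen_ball,
          fun h => (h.mono_left subset_closure).closure_right hopen⟩
    _ ↔ ∀ z ∈ Set.Icc (a : ℝ) b ×ℂ Set.Icc (c : ℝ) d, (r : ℝ) ≤ ‖z‖ := by
        rw [Complex.closure_reProdIm, closure_Ioo hab'.ne, closure_Ioo hcd'.ne, Set.disjoint_left]
        simp only [mem_ball_zero_iff, not_lt]
    _ ↔ r ^ 2 ≤ minAbs a b ^ 2 + minAbs c d ^ 2 := by
        rw [forall_le_norm_reProdIm_Icc_iff hab'.le hcd'.le hr'.le]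
        unfold minAbs
        exact_mod_cast Iff.rfl

theorem not_diskExterior_subset_openRect : ¬ diskExterior r ⊆ openRect a b c d :=
  fun h => infty_notMem_openRect (h infty_mem_diskExterior)

theorem diskExterior_subset_diskExterior_iff (hr : 0 < r) :
    diskExterior r ⊆ diskExterior r' ↔ r' ≤ r := by
  rw [diskExterior, diskExterior, Set.compl_subset_compl,
    Set.image_subset_image_iff OnePoint.coe_injective]
  refine ⟨fun h => ?_, fun h => Metric.closedBall_subset_closedBall (mod_cast h)⟩
  rcases lt_or_ge r' 0 with hr' | hr'
  · exact hr'.le.trans hr.le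
  have hnorm : ‖((r' : ℝ) : ℂ)‖ = r' := Complex.norm_of_nonneg (mod_cast hr')
  have hle := mem_closedBall_zero_iff.1 (h (mem_closedBall_zero_iff.2 hnorm.le))
  rw [hnorm] at hle
  exact_mod_cast hle

theorem disjoint_openRect_openRect_iff :
    Disjoint (openRect a b c d) (openRect a' b' c' d') ↔
      min b b' ≤ max a a' ∨ min d d' ≤ max c c' := by
  rw [openRect_eq_image, openRect_eq_image, Set.disjoint_image_iff OnePoint.coe_injective,
    disjoint_reProdIm, Set.Ioo_disjoint_Ioo, Set.Ioo_disjoint_Ioo]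
  exact_mod_cast Iff.rfl

theorem disjoint_openRect_diskExterior_iff (hab : a < b) (hcd : c < d) (hr : 0 < r) :
    Disjoint (openRect a b c d) (diskExterior r) ↔ maxAbs a b ^ 2 + maxAbs c d ^ 2 ≤ r ^ 2 := by
  have hab' : (a : ℝ) < b := mod_cast hab
  have hcd' : (c : ℝ) < d := mod_cast hcd
  have hr' : (0 : ℝ) < r := mod_cast hr
  calc Disjoint (openRect a b c d) (diskExterior r)
      ↔ closure (Set.Ioo (a : ℝ) b ×ℂ Set.Ioo (c : ℝ) d) ⊆ Metric.closedBall 0 r := by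
        rw [openRect_eq_image, diskExterior, Set.disjoint_compl_right_iff_subset,
          Set.image_subset_image_iff OnePoint.coe_injective,
          Metric.isClosed_closedBall.closure_subset_iff]
    _ ↔ ∀ z ∈ Set.Icc (a : ℝ) b ×ℂ Set.Icc (c : ℝ) d, ‖z‖ ≤ r := by
        rw [Complex.closure_reProdIm, closure_Ioo hab'.ne, closure_Ioo hcd'.ne]
        simp only [Set.subset_def, mem_closedBall_zero_iff]
    _ ↔ maxAbs a b ^ 2 + maxAbs c d ^ 2 ≤ r ^ 2 := by
        rw [forall_norm_le_reProdIm_Icc_iff hab'.le hcd'.le hr'.le]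
        unfold maxAbs
        exact_mod_cast Iff.rfl

theorem not_disjoint_diskExterior_diskExterior :
    ¬ Disjoint (diskExterior r) (diskExterior r') :=
  fun h => Set.disjoint_left.1 h infty_mem_diskExterior infty_mem_diskExterior

end BasicSets

/-! ### Primitive recursiveness -/

/- Registering `Primrec` and `PrimrecPred` with `fun_prop`, which needs pointwise forms of the
closure properties, reduces the routine primitive recursiveness proofs below to one tactic call. -/
attribute [fun_prop] Primrec PrimrecPred Primrec.id Primrec.const Primrec.comp Primrec.pair
  Primrec.fst Primrec.snd Primrec.unpair PrimrecPred.comp PrimrecPred.and PrimrecPred.or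
  PrimrecPred.not Primrec.ite

section

variable {α β γ : Type*} [Primcodable α] [Primcodable β] [Primcodable γ]

section NatValued

variable {f g : α → ℕ} (hf : Primrec f) (hg : Primrec g)

include hf hg

@[fun_prop]
theorem primrec_natPair : Primrec fun a => Nat.pair (f a) (g a) := Primrec₂.natPair.comp hf hg

@[fun_prop]
theorem primrec_natAdd : Primrec fun a => f a + g a := Primrec.nat_add.comp hf hg

@[fun_prop]
theorem primrec_natSub : Primrec fun a => f a - g a := Primrec.nat_sub.comp hf hg

@[fun_prop]
theorem primrec_natMul : Primrec fun a => f a * g a := Primrec.nat_mul.comp hf hg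

@[fun_prop]
theorem primrec_natDiv : Primrec fun a => f a / g a := Primrec.nat_div.comp hf hg

@[fun_prop]
theorem primrec_natMod : Primrec fun a => f a % g a := Primrec.nat_mod.comp hf hg

@[fun_prop]
theorem primrecPred_natLe : PrimrecPred fun a => f a ≤ g a := Primrec.nat_le.comp hf hg

end NatValued

@[fun_prop]
theorem primrecPred_eq {f g : α → β} (hf : Primrec f) (hg : Primrec g) :
    PrimrecPred fun a => f a = g a :=
  Primrec.eq.comp hf hg

end

/-- A rational-valued function is primitive recursive if it has primitive recursive numerators and
denominators. Numerators are differences of natural numbers, and denominators are shifted by one to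
keep them nonzero. -/
@[fun_prop]
def PrimrecRat {α : Type*} [Primcodable α] (f : α → ℚ) : Prop :=
  ∃ p q d : α → ℕ, Primrec p ∧ Primrec q ∧ Primrec d ∧ ∀ a, f a = ((p a : ℚ) - q a) / (d a + 1)

namespace PrimrecRat

variable {α β : Type*} [Primcodable α] [Primcodable β] {f g : α → ℚ}

@[fun_prop]
theorem comp {h : β → α} (hf : PrimrecRat f) (hh : Primrec h) : PrimrecRat fun b => f (h b) := by
  obtain ⟨p, q, d, hp, hq, hd, hfrac⟩ := hf
  exact ⟨_, _, _, hp.comp hh, hq.comp hh, hd.comp hh, fun b => hfrac (h b)⟩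

@[fun_prop]
theorem ratOfNat : PrimrecRat ratOfNat :=
  ⟨fun n => n.unpair.1.unpair.1, fun n => n.unpair.1.unpair.2, fun n => n.unpair.2,
    by fun_prop, by fun_prop, by fun_prop, fun _ => rfl⟩

@[fun_prop]
theorem posRatOfNat : PrimrecRat posRatOfNat :=
  ⟨fun n => n.unpair.1 + 1, fun _ => 0, fun n => n.unpair.2, by fun_prop, by fun_prop,
    by fun_prop, fun n => by simp [_root_.posRatOfNat]⟩

@[fun_prop]
theorem natCast {f : α → ℕ} (hf : Primrec f) : PrimrecRat fun a => (f a : ℚ) :=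
  ⟨f, fun _ => 0, fun _ => 0, hf, by fun_prop, by fun_prop, fun a => by simp⟩

@[fun_prop]
theorem neg (hf : PrimrecRat f) : PrimrecRat fun a => -f a := by
  obtain ⟨p, q, d, hp, hq, hd, h⟩ := hf
  exact ⟨q, p, d, hq, hp, hd, fun a => by simp only [h, ← neg_div, neg_sub]⟩

@[fun_prop]
theorem add (hf : PrimrecRat f) (hg : PrimrecRat g) : PrimrecRat fun a => f a + g a := by
  obtain ⟨p, q, d, hp, hq, hd, h⟩ := hf
  obtain ⟨p', q', d', hp', hq', hd', h'⟩ := hg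
  refine ⟨fun a => p a * (d' a + 1) + p' a * (d a + 1),
    fun a => q a * (d' a + 1) + q' a * (d a + 1), fun a => d a * d' a + d a + d' a,
    by fun_prop, by fun_prop, by fun_prop, fun a => ?_⟩
  simp only [h, h']
  push_cast
  field_simp
  ring

@[fun_prop]
theorem mul (hf : PrimrecRat f) (hg : PrimrecRat g) : PrimrecRat fun a => f a * g a := by
  obtain ⟨p, q, d, hp, hq, hd, h⟩ := hf
  obtain ⟨p', q', d', hp', hq', hd', h'⟩ := hg
  refine ⟨fun a => p a * p' a + q a * q' a, fun a => p a * q' a + q a * p' a,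
    fun a => d a * d' a + d a + d' a, by fun_prop, by fun_prop, by fun_prop, fun a => ?_⟩
  simp only [h, h']
  push_cast
  field_simp
  ring

@[fun_prop]
theorem sq (hf : PrimrecRat f) : PrimrecRat fun a => f a ^ 2 := by
  simpa only [pow_two] using hf.mul hf

@[fun_prop]
theorem le (hf : PrimrecRat f) (hg : PrimrecRat g) : PrimrecPred fun a => f a ≤ g a := by
  obtain ⟨p, q, d, hp, hq, hd, h⟩ := hf
  obtain ⟨p', q', d', hp', hq', hd', h'⟩ := hg
  have hcross : PrimrecPred fun a =>
      p a * (d' a + 1) + q' a * (d a + 1) ≤ p' a * (d a + 1) + q a * (d' a + 1) := by fun_prop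
  refine hcross.of_eq fun a => ?_
  rw [h, h', div_le_div_iff₀ (by positivity) (by positivity), ← Nat.cast_le (α := ℚ)]
  push_cast
  constructor <;> intro hle <;> linarith

@[fun_prop]
theorem max (hf : PrimrecRat f) (hg : PrimrecRat g) : PrimrecRat fun a => max (f a) (g a) := by
  have hle := hf.le hg
  obtain ⟨p, q, d, hp, hq, hd, h⟩ := hf
  obtain ⟨p', q', d', hp', hq', hd', h'⟩ := hg
  refine ⟨_, _, _, Primrec.ite hle hp' hp, Primrec.ite hle hq' hq, Primrec.ite hle hd' hd,
    fun a => ?_⟩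
  simp only [max_def]
  split_ifs
  exacts [h' a, h a]

@[fun_prop]
theorem min (hf : PrimrecRat f) (hg : PrimrecRat g) : PrimrecRat fun a => min (f a) (g a) := by
  simpa only [max_neg_neg, neg_neg] using (hf.neg.max hg.neg).neg

@[fun_prop]
theorem minAbs (hf : PrimrecRat f) (hg : PrimrecRat g) :
    PrimrecRat fun a => minAbs (f a) (g a) := by
  have hzero : PrimrecRat fun _ : α => (0 : ℚ) := mod_cast natCast (Primrec.const 0)
  exact hzero.max (hf.max hg.neg)

@[fun_prop]
theorem maxAbs (hf : PrimrecRat f) (hg : PrimrecRat g) : PrimrecRat fun a => maxAbs (f a) (g a) :=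
  hf.neg.max hg

end PrimrecRat

/-- The left side of the rectangle with the number `n`. -/
def rectLeft (n : ℕ) : ℚ := ratOfNat n.unpair.1.unpair.1

/-- The right side of the rectangle with the number `n`. -/
def rectRight (n : ℕ) : ℚ := rectLeft n + posRatOfNat n.unpair.1.unpair.2

/-- The lower side of the rectangle with the number `n`. -/
def rectLower (n : ℕ) : ℚ := ratOfNat n.unpair.2.unpair.1

/-- The upper side of the rectangle with the number `n`. -/
def rectUpper (n : ℕ) : ℚ := rectLower n + posRatOfNat n.unpair.2.unpair.2

@[fun_prop]
theorem primrecRat_rectLeft : PrimrecRat rectLeft := by unfold rectLeft; fun_prop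

@[fun_prop]
theorem primrecRat_rectRight : PrimrecRat rectRight := by unfold rectRight; fun_prop

@[fun_prop]
theorem primrecRat_rectLower : PrimrecRat rectLower := by unfold rectLower; fun_prop

@[fun_prop]
theorem primrecRat_rectUpper : PrimrecRat rectUpper := by unfold rectUpper; fun_prop

theorem rectLeft_lt_rectRight (n : ℕ) : rectLeft n < rectRight n :=
  lt_add_of_pos_right _ (posRatOfNat_pos _)

theorem rectLower_lt_rectUpper (n : ℕ) : rectLower n < rectUpper n :=
  lt_add_of_pos_right _ (posRatOfNat_pos _)

theorem basicOfNat_of_even {n : ℕ} (h : n % 2 = 0) : basicOfNat n =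
    openRect (rectLeft (n / 2)) (rectRight (n / 2)) (rectLower (n / 2)) (rectUpper (n / 2)) :=
  if_pos h

theorem basicOfNat_of_not_even {n : ℕ} (h : ¬ n % 2 = 0) :
    basicOfNat n = diskExterior (posRatOfNat (n / 2)) :=
  if_neg h

theorem basicOfNat_subset_basicOfNat_iff {u v : ℕ} : basicOfNat u ⊆ basicOfNat v ↔
    u % 2 = 0 ∧ v % 2 = 0 ∧
      (rectLeft (v / 2) ≤ rectLeft (u / 2) ∧ rectRight (u / 2) ≤ rectRight (v / 2)) ∧
      rectLower (v / 2) ≤ rectLower (u / 2) ∧ rectUpper (u / 2) ≤ rectUpper (v / 2) ∨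
    u % 2 = 0 ∧ ¬ v % 2 = 0 ∧
      posRatOfNat (v / 2) ^ 2 ≤ minAbs (rectLeft (u / 2)) (rectRight (u / 2)) ^ 2 +
        minAbs (rectLower (u / 2)) (rectUpper (u / 2)) ^ 2 ∨
    ¬ u % 2 = 0 ∧ ¬ v % 2 = 0 ∧ posRatOfNat (v / 2) ≤ posRatOfNat (u / 2) := by
  by_cases hu : u % 2 = 0 <;> by_cases hv : v % 2 = 0
  · simp [hu, hv, basicOfNat_of_even,
      openRect_subset_openRect_iff (rectLeft_lt_rectRight _) (rectLower_lt_rectUpper _)]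
  · simp [hu, hv, basicOfNat_of_even, basicOfNat_of_not_even, openRect_subset_diskExterior_iff
      (rectLeft_lt_rectRight _) (rectLower_lt_rectUpper _) (posRatOfNat_pos _)]
  · simp [hu, hv, basicOfNat_of_even, basicOfNat_of_not_even, not_diskExterior_subset_openRect]
  · simp [hu, hv, basicOfNat_of_not_even, diskExterior_subset_diskExterior_iff (posRatOfNat_pos _)]

theorem disjoint_basicOfNat_basicOfNat_iff {u v : ℕ} : Disjoint (basicOfNat u) (basicOfNat v) ↔
    u % 2 = 0 ∧ v % 2 = 0 ∧
      (min (rectRight (u / 2)) (rectRight (v / 2)) ≤ max (rectLeft (u / 2)) (rectLeft (v / 2)) ∨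
        min (rectUpper (u / 2)) (rectUpper (v / 2)) ≤
          max (rectLower (u / 2)) (rectLower (v / 2))) ∨
    u % 2 = 0 ∧ ¬ v % 2 = 0 ∧ maxAbs (rectLeft (u / 2)) (rectRight (u / 2)) ^ 2 +
        maxAbs (rectLower (u / 2)) (rectUpper (u / 2)) ^ 2 ≤ posRatOfNat (v / 2) ^ 2 ∨
    ¬ u % 2 = 0 ∧ v % 2 = 0 ∧ maxAbs (rectLeft (v / 2)) (rectRight (v / 2)) ^ 2 +
        maxAbs (rectLower (v / 2)) (rectUpper (v / 2)) ^ 2 ≤ posRatOfNat (u / 2) ^ 2 := by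
  have hmixed (m n : ℕ) := disjoint_openRect_diskExterior_iff (rectLeft_lt_rectRight m)
    (rectLower_lt_rectUpper m) (posRatOfNat_pos n)
  by_cases hu : u % 2 = 0 <;> by_cases hv : v % 2 = 0
  · simp [hu, hv, basicOfNat_of_even, disjoint_openRect_openRect_iff]
  · simp [hu, hv, basicOfNat_of_even, basicOfNat_of_not_even, hmixed]
  · simp [hu, hv, basicOfNat_of_even, basicOfNat_of_not_even, disjoint_comm (a := diskExterior _),
      hmixed]
  · simp [hu, hv, basicOfNat_of_not_even, not_disjoint_diskExterior_diskExterior]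

@[fun_prop]
theorem primrecPred_basicOfNat_subset {α : Type*} [Primcodable α] {f g : α → ℕ} (hf : Primrec f)
    (hg : Primrec g) : PrimrecPred fun a => basicOfNat (f a) ⊆ basicOfNat (g a) := by
  simp only [basicOfNat_subset_basicOfNat_iff]
  fun_prop

@[fun_prop]
theorem primrecPred_disjoint_basicOfNat {α : Type*} [Primcodable α] {f g : α → ℕ}
    (hf : Primrec f) (hg : Primrec g) :
    PrimrecPred fun a => Disjoint (basicOfNat (f a)) (basicOfNat (g a)) := by
  simp only [disjoint_basicOfNat_basicOfNat_iff]
  fun_prop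

/-! ### Simulation of oracle machines -/

open Nat.Partrec (Code)
open Filter Topology Set

namespace OracleCode

/-- The partial function computed by a code when queries to the oracle may diverge. It is the
common generalization of `eval`, where the oracle is total, and of runs on a finite piece of an
oracle. -/
def evalPart (O : ℕ →. ℕ) : OracleCode → ℕ →. ℕ
  | zero => pure 0
  | succ => Nat.succ
  | left => ↑fun n : ℕ => n.unpair.1
  | right => ↑fun n : ℕ => n.unpair.2
  | oracle => O
  | pair cf cg => fun n => Nat.pair <$> evalPart O cf n <*> evalPart O cg n
  | comp cf cg => fun n => evalPart O cg n >>= evalPart O cf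
  | prec cf cg =>
    Nat.unpaired fun a n =>
      n.rec (evalPart O cf a) fun y IH => do
        let i ← IH
        evalPart O cg (Nat.pair a (Nat.pair y i))
  | rfind' cf =>
    Nat.unpaired fun a m =>
      (Nat.rfind fun n => (fun k => k = 0) <$> evalPart O cf (Nat.pair a (n + m))).map (· + m)

theorem evalPart_coe (A : ℕ → ℕ) (c : OracleCode) : c.evalPart A = c.eval A := by
  induction c with
  | zero | succ | left | right | oracle => rfl
  | pair a b iha ihb | comp a b iha ihb | prec a b iha ihb =>
    simp only [evalPart, eval, iha, ihb]; rfl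
  | rfind' a iha => simp only [evalPart, eval, iha]; rfl

theorem evalPart_prec (O : ℕ →. ℕ) (a b : OracleCode) (x m : ℕ) :
    (prec a b).evalPart O (Nat.pair x m) =
      m.rec (a.evalPart O x) fun y IH =>
        IH >>= fun i => b.evalPart O (Nat.pair x (Nat.pair y i)) := by
  simp only [evalPart, Nat.unpaired, Nat.unpair_pair]

theorem mem_evalPart_rfind' {O : ℕ →. ℕ} {a : OracleCode} {x m y : ℕ} :
    y ∈ (rfind' a).evalPart O (Nat.pair x m) ↔
      ∃ k, 0 ∈ a.evalPart O (Nat.pair x (k + m)) ∧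
        (∀ i < k, ∃ j ∈ a.evalPart O (Nat.pair x (i + m)), j ≠ 0) ∧ k + m = y := by
  simp only [evalPart, Nat.unpaired, Nat.unpair_pair, Part.mem_map_iff, ← and_assoc]
  refine exists_congr fun k => and_congr_left fun _ => Nat.mem_rfind.trans ?_
  simp [Part.map_eq_map]

/-- Queries are answered in finite time, so a halting run survives a good enough approximation
of the oracle: `evalPart` is Scott continuous in the oracle. -/
theorem eventually_mem_evalPart {ι : Type*} {l : Filter ι} {O : ι → ℕ →. ℕ} {A : ℕ →. ℕ}
    (hO : ∀ i, ∀ v ∈ A i, ∀ᶠ m in l, v ∈ O m i) (c : OracleCode) {n x : ℕ}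
    (hx : x ∈ c.evalPart A n) : ∀ᶠ m in l, x ∈ c.evalPart (O m) n := by
  induction c generalizing n x with
  | zero | succ | left | right => exact .of_forall fun _ => hx
  | oracle => exact hO n x hx
  | pair a b iha ihb =>
    simp only [evalPart, Seq.seq, Part.map_eq_map, Part.mem_bind_iff, Part.mem_map_iff] at hx ⊢
    obtain ⟨_, ⟨u, hu, rfl⟩, v, hv, rfl⟩ := hx
    filter_upwards [iha hu, ihb hv] with m hu hv
    exact ⟨_, ⟨u, hu, rfl⟩, v, hv, rfl⟩
  | comp a b iha ihb =>
    obtain ⟨u, hu, hx⟩ := Part.mem_bind_iff.1 hx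
    filter_upwards [ihb hu, iha hx] with m hu hx
    exact Part.mem_bind_iff.2 ⟨u, hu, hx⟩
  | prec a b iha ihb =>
    obtain ⟨y, k, rfl⟩ : ∃ y k, n = Nat.pair y k := ⟨_, _, (Nat.pair_unpair n).symm⟩
    simp only [evalPart_prec] at hx ⊢
    induction k generalizing x with
    | zero => exact iha hx
    | succ k ih =>
      obtain ⟨u, hu, hx⟩ := Part.mem_bind_iff.1 hx
      filter_upwards [ih hu, ihb hx] with m hu hx
      exact Part.mem_bind_iff.2 ⟨u, hu, hx⟩
  | rfind' a iha =>
    obtain ⟨y, k, rfl⟩ : ∃ y k, n = Nat.pair y k := ⟨_, _, (Nat.pair_unpair n).symm⟩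
    simp only [mem_evalPart_rfind'] at hx ⊢
    obtain ⟨t, ht, hlt, rfl⟩ := hx
    have hlt : ∀ᶠ m in l, ∀ i < t, ∃ j ∈ a.evalPart (O m) (Nat.pair y (i + k)), j ≠ 0 :=
      (eventually_all_finite (finite_lt_nat t)).2 fun i hi =>
        let ⟨j, hj, hj'⟩ := hlt i hi
        (iha hj).mono fun _ hm => ⟨j, hm, hj'⟩
    filter_upwards [iha ht, hlt] with m hm hlt
    exact ⟨t, hm, hlt, rfl⟩

theorem mem_evalPart_mono {O A : ℕ →. ℕ} (hAO : ∀ i, ∀ v ∈ A i, v ∈ O i) (c : OracleCode) {n x : ℕ}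
    (hx : x ∈ c.evalPart A n) : x ∈ c.evalPart O n :=
  eventually_pure.1 (eventually_mem_evalPart (l := pure ()) (O := fun _ => O)
    (fun i v hv => eventually_pure.2 (hAO i v hv)) c hx)

end OracleCode

@[fun_prop]
theorem primrec_codePair {α : Type*} [Primcodable α] {f g : α → Code} (hf : Primrec f)
    (hg : Primrec g) : Primrec fun a => (f a).pair (g a) :=
  Code.primrec₂_pair.comp hf hg

@[fun_prop]
theorem primrec_codeComp {α : Type*} [Primcodable α] {f g : α → Code} (hf : Primrec f)
    (hg : Primrec g) : Primrec fun a => (f a).comp (g a) :=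
  Code.primrec₂_comp.comp hf hg

@[fun_prop]
theorem primrec_codePrec {α : Type*} [Primcodable α] {f g : α → Code} (hf : Primrec f)
    (hg : Primrec g) : Primrec fun a => (f a).prec (g a) :=
  Code.primrec₂_prec.comp hf hg

attribute [fun_prop] Code.primrec_rfind' Primrec.list_length Primrec.ofNat Primrec.encode
  Primrec.option_some

@[fun_prop]
theorem primrec_listGetD {α β : Type*} [Primcodable α] [Primcodable β] {l : α → List β}
    {n : α → ℕ} {d : β} (hl : Primrec l) (hn : Primrec n) : Primrec fun a => (l a).getD (n a) d :=
  (Primrec.list_getD d).comp hl hn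

@[fun_prop]
theorem primrec_listGetElem? {α β : Type*} [Primcodable α] [Primcodable β] {l : α → List β}
    {n : α → ℕ} (hl : Primrec l) (hn : Primrec n) : Primrec fun a => (l a)[n a]? :=
  Primrec.list_getElem?.comp hl hn

theorem exists_eval_eq_listGetElem? : ∃ c : Code, ∀ (l : List ℕ) (n : ℕ),
    c.eval (Nat.pair (Encodable.encode l) n) = (l[n]? : Part ℕ) := by
  have h : Primrec fun m : ℕ => (Denumerable.ofNat (List ℕ) m.unpair.1)[m.unpair.2]? := by
    fun_prop
  obtain ⟨c, hc⟩ := Code.exists_code.1 (Partrec.nat_iff.1 h.to_comp.ofOption)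
  exact ⟨c, fun l n => by simp [hc]⟩

/-- A code that looks up an entry of a finite list and diverges outside of it: it plays the role of
the oracle in `OracleCode.simulate`. -/
noncomputable def lookupCode : Code := exists_eval_eq_listGetElem?.choose

theorem eval_lookupCode (l : List ℕ) (n : ℕ) :
    lookupCode.eval (Nat.pair (Encodable.encode l) n) = (l[n]? : Part ℕ) :=
  exists_eval_eq_listGetElem?.choose_spec l n

/-- A code that rearranges `((l, x), y)` to `(l, (x, y))`. -/
def assocCode : Code :=
  .pair (.comp .left .left) (.pair (.comp .right .left) .right)

/-- A code that rearranges `(l, (x, y))` to `((l, x), y)`. -/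
def unassocCode : Code :=
  .pair (.pair .left (.comp .left .right)) (.comp .right .right)

theorem eval_comp_of_eq {c d : Code} {n m : ℕ} (h : d.eval n = Part.some m) :
    (c.comp d).eval n = c.eval m := by
  change d.eval n >>= c.eval = c.eval m
  rw [h]
  exact Part.bind_some m c.eval

theorem eval_pair_of_eq {c d : Code} {n x y : ℕ} (hc : c.eval n = Part.some x)
    (hd : d.eval n = Part.some y) : (c.pair d).eval n = Part.some (Nat.pair x y) := by
  simp [Code.eval, hc, hd, Seq.seq]

theorem eval_assocCode (l x y : ℕ) :
    assocCode.eval (Nat.pair (Nat.pair l x) y) = Part.some (Nat.pair l (Nat.pair x y)) := by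
  have h : Code.left.eval (Nat.pair (Nat.pair l x) y) = Part.some (Nat.pair l x) := by
    simp [Code.eval]
  refine eval_pair_of_eq ((eval_comp_of_eq h).trans ?_)
    (eval_pair_of_eq ((eval_comp_of_eq h).trans ?_) ?_) <;> simp [Code.eval]

theorem eval_unassocCode (l x y : ℕ) :
    unassocCode.eval (Nat.pair l (Nat.pair x y)) = Part.some (Nat.pair (Nat.pair l x) y) := by
  have h : Code.right.eval (Nat.pair l (Nat.pair x y)) = Part.some (Nat.pair x y) := by
    simp [Code.eval]
  refine eval_pair_of_eq (eval_pair_of_eq ?_ ((eval_comp_of_eq h).trans ?_))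
    ((eval_comp_of_eq h).trans ?_) <;> simp [Code.eval]

namespace OracleCode

/-- The oracle-free code that, on input `(l, n)`, runs the oracle machine on `n` with the finite
list `l` in the place of the oracle. -/
noncomputable def simulate : OracleCode → Code
  | zero => .zero
  | succ => .comp .succ .right
  | left => .comp .left .right
  | right => .comp .right .right
  | oracle => lookupCode
  | pair a b => .pair (simulate a) (simulate b)
  | comp a b => .comp (simulate a) (.pair .left (simulate b))
  | prec a b => .comp (.prec (simulate a) (.comp (simulate b) assocCode)) unassocCode
  | rfind' a => .comp (.rfind' (.comp (simulate a) assocCode)) unassocCode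

/-- The partial oracle that answers from a finite list and diverges outside of it. -/
def listOracle (l : List ℕ) : ℕ →. ℕ := fun i => (l[i]? : Part ℕ)

theorem mem_listOracle {l : List ℕ} {i v : ℕ} : v ∈ listOracle l i ↔ l[i]? = some v := by
  simp [listOracle]

theorem eval_simulate (c : OracleCode) (l : List ℕ) (n : ℕ) :
    c.simulate.eval (Nat.pair (Encodable.encode l) n) = c.evalPart (listOracle l) n := by
  have hright (n : ℕ) : Code.right.eval (Nat.pair (Encodable.encode l) n) = Part.some n := by
    simp [Code.eval]
  induction c generalizing n with
  | zero => rfl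
  | succ | left | right => exact eval_comp_of_eq (hright n)
  | oracle => exact eval_lookupCode l n
  | pair a b iha ihb => simp only [simulate, Code.eval, evalPart, iha, ihb]
  | comp a b iha ihb =>
    have hb : (Code.pair .left b.simulate).eval (Nat.pair (Encodable.encode l) n) =
        (b.evalPart (listOracle l) n).map (Nat.pair (Encodable.encode l)) := by
      simp [Code.eval, ihb, Seq.seq, Part.map_eq_map]
    exact (congrArg (· >>= a.simulate.eval) hb).trans
      ((Part.bind_map ..).trans (congrArg (Part.bind _) (funext iha)))
  | prec a b iha ihb =>
    obtain ⟨x, m, rfl⟩ : ∃ x m, n = Nat.pair x m := ⟨_, _, (Nat.pair_unpair n).symm⟩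
    rw [simulate, eval_comp_of_eq (eval_unassocCode _ x m), evalPart_prec]
    induction m with
    | zero => exact (Code.eval_prec_zero ..).trans (iha x)
    | succ m ih =>
      rw [Code.eval_prec_succ]
      simp only [ih, eval_comp_of_eq (eval_assocCode ..), ihb]
  | rfind' a iha =>
    obtain ⟨x, m, rfl⟩ : ∃ x m, n = Nat.pair x m := ⟨_, _, (Nat.pair_unpair n).symm⟩
    have hassoc (k : ℕ) := eval_comp_of_eq (c := a.simulate)
      (eval_assocCode (Encodable.encode l) x k)
    rw [simulate, eval_comp_of_eq (eval_unassocCode _ x m)]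
    rw [Code.eval]
    simp only [evalPart, Nat.unpaired, Nat.unpair_pair, hassoc, iha]

theorem toNat_surjective : Function.Surjective toNat := by
  intro n
  induction n using Nat.strong_induction_on with | _ n ih =>
  rcases Nat.lt_or_ge n 5 with hn | hn
  · interval_cases n
    exacts [⟨zero, rfl⟩, ⟨succ, rfl⟩, ⟨left, rfl⟩, ⟨right, rfl⟩, ⟨oracle, rfl⟩]
  · obtain ⟨c, hc⟩ := ih ((n - 5) / 4) (by omega)
    obtain ⟨a, ha⟩ := ih ((n - 5) / 4).unpair.1 (by grind [Nat.unpair_left_le])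
    obtain ⟨b, hb⟩ := ih ((n - 5) / 4).unpair.2 (by grind [Nat.unpair_right_le])
    have hpair := Nat.pair_unpair ((n - 5) / 4)
    obtain h | h | h | h : (n - 5) % 4 = 0 ∨ (n - 5) % 4 = 1 ∨ (n - 5) % 4 = 2 ∨ (n - 5) % 4 = 3 :=
      by omega
    · exact ⟨pair a b, by simp only [toNat, ha, hb, hpair]; omega⟩
    · exact ⟨comp a b, by simp only [toNat, ha, hb, hpair]; omega⟩
    · exact ⟨prec a b, by simp only [toNat, ha, hb, hpair]; omega⟩
    · exact ⟨rfind' c, by simp only [toNat, hc]; omega⟩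

/-- `simulate` as a function of the number of a code. -/
noncomputable def simulateNat (n : ℕ) : Code :=
  (Function.surjInv toNat_surjective n).simulate

theorem simulateNat_toNat (c : OracleCode) : simulateNat c.toNat = c.simulate := by
  rw [simulateNat, Function.leftInverse_surjInv ⟨toNat_injective, toNat_surjective⟩ c]

/-- The value of `simulateNat` at `n`, computed from the list `h` of its values below `n`. -/
noncomputable def simulateStep (h : List Code) : Code :=
  let m := (h.length - 5) / 4
  let a := h.getD m.unpair.1 .zero
  let b := h.getD m.unpair.2 .zero
  if h.length = 0 then .zero
  else if h.length = 1 then .comp .succ .right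
  else if h.length = 2 then .comp .left .right
  else if h.length = 3 then .comp .right .right
  else if h.length = 4 then lookupCode
  else if (h.length - 5) % 4 = 0 then .pair a b
  else if (h.length - 5) % 4 = 1 then .comp a (.pair .left b)
  else if (h.length - 5) % 4 = 2 then .comp (.prec a (.comp b assocCode)) unassocCode
  else .comp (.rfind' (.comp (h.getD m .zero) assocCode)) unassocCode

theorem primrec_simulateStep : Primrec simulateStep := by
  unfold simulateStep
  fun_prop

theorem simulateStep_map_simulateNat (n : ℕ) :
    simulateStep ((List.range n).map simulateNat) = simulateNat n := by
  obtain ⟨c, rfl⟩ := toNat_surjective n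
  have h1 (p : ℕ) : (4 * p + 1) / 4 = p := by omega
  have h2 (p : ℕ) : (4 * p + 2) / 4 = p := by omega
  have h3 (p : ℕ) : (4 * p + 3) / 4 = p := by omega
  rw [simulateNat_toNat]
  cases c with
  | zero | succ | left | right | oracle => simp [simulateStep, toNat, simulate]
  | pair a b | comp a b | prec a b =>
    have ha := Nat.left_le_pair a.toNat b.toNat
    have hb := Nat.right_le_pair a.toNat b.toNat
    simp (disch := omega) [simulateStep, toNat, simulate, h1, h2, List.getElem?_range,
      simulateNat_toNat]
  | rfind' a =>
    simp (disch := omega) [simulateStep, toNat, simulate, h3, List.getElem?_range,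
      simulateNat_toNat]

@[fun_prop]
theorem primrec_simulateNat : Primrec simulateNat := by
  have h : Primrec₂ fun (_ : Unit) n => simulateNat n :=
    Primrec.nat_strong_rec _ (g := fun _ h => some (simulateStep h))
      (Primrec.option_some.comp (primrec_simulateStep.comp Primrec.snd))
      fun _ n => congrArg some (simulateStep_map_simulateNat n)
  exact h.comp (Primrec.const ()) Primrec.id

end OracleCode

/-! ### Semidecidability relative to an oracle -/

/-- The first `m` symbols of the sequence `A`. -/
def oraclePrefix (A : ℕ → ℕ) (m : ℕ) : List ℕ :=
  (List.range m).map A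

@[simp]
theorem length_oraclePrefix (A : ℕ → ℕ) (m : ℕ) : (oraclePrefix A m).length = m := by
  simp [oraclePrefix]

theorem oraclePrefix_getElem?_eq_some {A : ℕ → ℕ} {m i v : ℕ} :
    (oraclePrefix A m)[i]? = some v ↔ i < m ∧ A i = v := by
  by_cases h : i < m <;> simp [oraclePrefix, h]

theorem oraclePrefix_succ (A : ℕ → ℕ) (n : ℕ) :
    oraclePrefix A (n + 1) = oraclePrefix A n ++ [A n] := by
  simp [oraclePrefix, List.range_succ]

theorem primrecPred_exists_lt {α : Type*} [Primcodable α] {p : α × ℕ → Prop} (hp : PrimrecPred p)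
    {n : α → ℕ} (hn : Primrec n) : PrimrecPred fun a => ∃ b < n a, p (a, b) := by
  have hR : PrimrecRel fun (b : ℕ) (a : α) => p (a, b) := by unfold PrimrecRel; fun_prop
  exact (PrimrecRel.comp hR.exists_mem_list (Primrec.list_range.comp hn) Primrec.id).of_eq
    fun a => by simp

theorem primrecPred_forall_lt {α : Type*} [Primcodable α] {p : α × ℕ → Prop} (hp : PrimrecPred p)
    {n : α → ℕ} (hn : Primrec n) : PrimrecPred fun a => ∀ b < n a, p (a, b) := by
  have hR : PrimrecRel fun (b : ℕ) (a : α) => p (a, b) := by unfold PrimrecRel; fun_prop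
  exact (PrimrecRel.comp hR.forall_mem_list (Primrec.list_range.comp hn) Primrec.id).of_eq
    fun a => by simp

/-- The relation `P A a` is semidecidable, uniformly in the oracle `A`: it holds if and only if a
primitive recursive test accepts `a` and some, equivalently every sufficiently long, initial segment
of `A`. -/
def OracleSemidecidable {α : Type*} [Primcodable α] (P : (ℕ → ℕ) → α → Prop) : Prop :=
  ∃ Q : List ℕ × α → Prop, PrimrecPred Q ∧
    (∀ A a, Monotone fun n => Q (oraclePrefix A n, a)) ∧
    ∀ A a, P A a ↔ ∃ n, Q (oraclePrefix A n, a)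

namespace OracleSemidecidable

variable {α β : Type*} [Primcodable α] {P P' : (ℕ → ℕ) → α → Prop}

theorem of_iff (h : OracleSemidecidable P) (H : ∀ A a, P A a ↔ P' A a) :
    OracleSemidecidable P' := by
  simpa only [OracleSemidecidable, H] using h

theorem of_primrecPred {R : α → Prop} (h : PrimrecPred R) :
    OracleSemidecidable fun _ a => R a :=
  ⟨fun x => R x.2, by fun_prop, fun _ _ _ _ _ h => h, fun _ _ => by simp⟩

theorem and (h : OracleSemidecidable P) (h' : OracleSemidecidable P') :
    OracleSemidecidable fun A a => P A a ∧ P' A a := by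
  obtain ⟨Q, hQ, hmono, hP⟩ := h
  obtain ⟨Q', hQ', hmono', hP'⟩ := h'
  refine ⟨fun x => Q x ∧ Q' x, by fun_prop,
    fun A a i j hij hi => ⟨hmono A a hij hi.1, hmono' A a hij hi.2⟩, fun A a => ?_⟩
  simp only [hP, hP']
  exact ⟨fun ⟨⟨i, hi⟩, j, hj⟩ =>
      ⟨max i j, hmono A a (le_max_left i j) hi, hmono' A a (le_max_right i j) hj⟩,
    fun ⟨i, hi, hi'⟩ => ⟨⟨i, hi⟩, i, hi'⟩⟩

theorem or (h : OracleSemidecidable P) (h' : OracleSemidecidable P') :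
    OracleSemidecidable fun A a => P A a ∨ P' A a := by
  obtain ⟨Q, hQ, hmono, hP⟩ := h
  obtain ⟨Q', hQ', hmono', hP'⟩ := h'
  refine ⟨fun x => Q x ∨ Q' x, by fun_prop,
    fun A a i j hij hi => hi.imp (hmono A a hij) (hmono' A a hij), fun A a => ?_⟩
  simp only [hP, hP', exists_or]

theorem exists_denumerable [Denumerable β] {P : (ℕ → ℕ) → α → β → Prop}
    (h : OracleSemidecidable fun A (x : α × β) => P A x.1 x.2) :
    OracleSemidecidable fun A a => ∃ b, P A a b := by
  obtain ⟨Q, hQ, hmono, hP⟩ := h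
  have hR : PrimrecPred fun x : (List ℕ × α) × ℕ =>
      Q (x.1.1, x.1.2, Denumerable.ofNat β x.2) := by fun_prop
  refine ⟨fun x => ∃ b < x.1.length, Q (x.1, x.2, Denumerable.ofNat β b),
    primrecPred_exists_lt hR (by fun_prop),
    fun A a i j hij hi => ?_, fun A a => ?_⟩
  · simp only [length_oraclePrefix] at hi ⊢
    exact hi.imp fun b hb => ⟨hb.1.trans_le hij, hmono A _ hij hb.2⟩
  · simp only [length_oraclePrefix]
    constructor
    · rintro ⟨b, hb⟩
      obtain ⟨n, hn⟩ := (hP A (a, b)).1 hb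
      refine ⟨max n (Encodable.encode b + 1), Encodable.encode b, by omega, ?_⟩
      simpa using hmono A (a, b) (le_max_left _ _) hn
    · rintro ⟨n, b, -, hb⟩
      exact ⟨_, (hP A (a, _)).2 ⟨n, hb⟩⟩

theorem forall_lt {P : (ℕ → ℕ) → α → ℕ → Prop}
    (h : OracleSemidecidable fun A (x : α × ℕ) => P A x.1 x.2) {g : α → ℕ} (hg : Primrec g) :
    OracleSemidecidable fun A a => ∀ b < g a, P A a b := by
  obtain ⟨Q, hQ, hmono, hP⟩ := h
  have hR : PrimrecPred fun x : (List ℕ × α) × ℕ => Q (x.1.1, x.1.2, x.2) := by fun_prop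
  refine ⟨fun x => ∀ b < g x.2, Q (x.1, x.2, b),
    primrecPred_forall_lt hR (by fun_prop),
    fun A a i j hij hi b hb => hmono A _ hij (hi b hb), fun A a => ?_⟩
  refine ⟨fun H => ?_, fun ⟨n, hn⟩ b hb => (hP A (a, b)).2 ⟨n, hn b hb⟩⟩
  have hall : ∀ᶠ n in atTop, ∀ b < g a, Q (oraclePrefix A n, a, b) :=
    (eventually_all_finite (finite_lt_nat (g a))).2 fun b hb =>
      let ⟨n, hn⟩ := (hP A (a, b)).1 (H b hb)
      (eventually_ge_atTop n).mono fun _ hnm => hmono A _ hnm hn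
  exact hall.exists

theorem oracle_eq {i v : α → ℕ} (hi : Primrec i) (hv : Primrec v) :
    OracleSemidecidable fun A a => A (i a) = v a := by
  refine ⟨fun x => x.1[i x.2]? = some (v x.2), by fun_prop, fun A a m n hmn hm => ?_,
    fun A a => ?_⟩
  · have := oraclePrefix_getElem?_eq_some.1 hm
    exact oraclePrefix_getElem?_eq_some.2 ⟨this.1.trans_le hmn, this.2⟩
  · simp only [oraclePrefix_getElem?_eq_some]
    exact ⟨fun h => ⟨i a + 1, by omega, h⟩, fun ⟨_, _, h⟩ => h⟩

theorem mem_eval {c : α → Code} {n v : α → ℕ} (hc : Primrec c) (hn : Primrec n)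
    (hv : Primrec v) : OracleSemidecidable fun _ a => v a ∈ (c a).eval (n a) := by
  have h : PrimrecPred fun x : α × ℕ => Code.evaln x.2 (c x.1) (n x.1) = some (v x.1) :=
    primrecPred_eq (Code.primrec_evaln.comp (by fun_prop :
      Primrec fun x : α × ℕ => ((x.2, c x.1), n x.1))) (by fun_prop)
  simp only [Code.evaln_complete]
  exact exists_denumerable (of_primrecPred h)

end OracleSemidecidable

namespace OracleCode

/-- An oracle-free code as an oracle code. -/
def ofCode : Code → OracleCode
  | .zero => zero
  | .succ => succ
  | .left => left
  | .right => right
  | .pair a b => pair (ofCode a) (ofCode b)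
  | .comp a b => comp (ofCode a) (ofCode b)
  | .prec a b => prec (ofCode a) (ofCode b)
  | .rfind' a => rfind' (ofCode a)

theorem eval_ofCode (A : ℕ → ℕ) (c : Code) : (ofCode c).eval A = c.eval := by
  induction c with
  | zero | succ | left | right => rfl
  | pair a b iha ihb | comp a b iha ihb | prec a b iha ihb =>
    simp only [ofCode, eval, Code.eval, iha, ihb]
    rfl
  | rfind' a iha =>
    simp only [ofCode, eval, Code.eval, iha]
    rfl

theorem exists_eval_eq_of_primrec {f : ℕ → ℕ} (hf : Primrec f) :
    ∃ c : OracleCode, ∀ A n, c.eval A n = Part.some (f n) := by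
  obtain ⟨c, hc⟩ := Code.exists_code.1 (Nat.Partrec.of_primrec (Primrec.nat_iff.1 hf))
  exact ⟨ofCode c, fun A n => by rw [eval_ofCode, hc]; rfl⟩

theorem eval_pair_of_eq {A : ℕ → ℕ} {a b : OracleCode} {n x y : ℕ}
    (ha : a.eval A n = Part.some x) (hb : b.eval A n = Part.some y) :
    (pair a b).eval A n = Part.some (Nat.pair x y) := by
  simp [eval, ha, hb, Seq.seq]

theorem eval_comp_of_eq {A : ℕ → ℕ} {a b : OracleCode} {n x : ℕ}
    (hb : b.eval A n = Part.some x) : (comp a b).eval A n = a.eval A x := by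
  simp only [eval, hb]
  exact Part.bind_some x (a.eval A)

theorem exists_eval_eq_encode_oraclePrefix :
    ∃ c : OracleCode, ∀ A n, c.eval A n = Part.some (Encodable.encode (oraclePrefix A n)) := by
  obtain ⟨append, happend⟩ := exists_eval_eq_of_primrec
    (f := fun m => Encodable.encode
      (Denumerable.ofNat (List ℕ) m.unpair.1.unpair.2.unpair.2 ++ [m.unpair.2])) <|
    Primrec.encode.comp (Primrec.list_concat.comp (by fun_prop) (by fun_prop))
  obtain ⟨i, hi⟩ := exists_eval_eq_of_primrec Primrec.id
  obtain ⟨index, hindex⟩ := exists_eval_eq_of_primrec (f := fun m => m.unpair.2.unpair.1)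
    (by fun_prop)
  refine ⟨comp (prec zero (comp append (pair i (comp oracle index)))) (pair zero i),
    fun A n => ?_⟩
  rw [eval_comp_of_eq (eval_pair_of_eq rfl (hi A n))]
  simp only [eval, Nat.unpaired, Nat.unpair_pair, id]
  induction n with
  | zero => rfl
  | succ n ih =>
    simp only [ih]
    refine (Part.bind_some _ _).trans ((eval_comp_of_eq (b := pair i (comp oracle index))
      (eval_pair_of_eq (hi A _) (eval_comp_of_eq (hindex A _)))).trans ?_)
    rw [happend, oraclePrefix_succ]
    simp

end OracleCode

theorem OracleSemidecidable.exists_machine {P : (ℕ → ℕ) → ℕ → Prop}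
    (h : OracleSemidecidable P) : ∃ M : OracleCode, ∀ A, ∃ q : ℕ → ℕ, M.Computes A q ∧
      ∀ k, P A k ↔ ∃ n, q n = k + 1 := by
  classical
  obtain ⟨Q, hQ, hmono, hP⟩ := h
  let F : ℕ → ℕ → ℕ := fun n l =>
    if Q (Denumerable.ofNat (List ℕ) l, n.unpair.1) then n.unpair.1 + 1 else 0
  have hF : Primrec fun m : ℕ => F m.unpair.1 m.unpair.2 := by
    unfold F
    fun_prop
  obtain ⟨c, hc⟩ := OracleCode.exists_eval_eq_of_primrec hF
  obtain ⟨i, hi⟩ := OracleCode.exists_eval_eq_of_primrec Primrec.id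
  obtain ⟨s, hs⟩ := OracleCode.exists_eval_eq_encode_oraclePrefix
  refine ⟨.comp c (.pair i s), fun A =>
    ⟨fun n => F n (Encodable.encode (oraclePrefix A n)), fun n => ?_, fun k => ?_⟩⟩
  · rw [OracleCode.eval_comp_of_eq (OracleCode.eval_pair_of_eq (hi A n) (hs A n)), hc]
    simp
  · simp only [F, Denumerable.ofNat_encode, hP]
    constructor
    · rintro ⟨n, hn⟩
      refine ⟨Nat.pair k n, ?_⟩
      simp [hmono A k (Nat.right_le_pair k n) hn]
    · rintro ⟨n, hn⟩
      split_ifs at hn with hQn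
      obtain rfl : n.unpair.1 = k := by omega
      exact ⟨n, hQn⟩

/-! ### Discrete open maps and the open mapping theorem on the sphere -/

section DiscreteOpen

variable {X Y Z : Type*} [TopologicalSpace X] [TopologicalSpace Y] [TopologicalSpace Z]

/-- The map `f` is open at `x`, and `x` is isolated in its fibre: the local form of the open
mapping theorem and of the discreteness of fibres for non-constant meromorphic functions. -/
def IsDiscreteOpenAt (f : X → Y) (x : X) : Prop :=
  𝓝 (f x) ≤ map f (𝓝 x) ∧ ∀ᶠ y in 𝓝 x, f y = f x → y = x

/-- The map `f` is open at every point of `U` and has discrete fibres there. -/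
def IsDiscreteOpenOn (f : X → Y) (U : Set X) : Prop :=
  ∀ x ∈ U, IsDiscreteOpenAt f x

theorem IsDiscreteOpenAt.congr {f g : X → Y} {x : X} (hf : IsDiscreteOpenAt f x)
    (h : f =ᶠ[𝓝 x] g) : IsDiscreteOpenAt g x := by
  refine ⟨?_, ?_⟩
  · rw [← h.self_of_nhds, ← Filter.map_congr h]
    exact hf.1
  · filter_upwards [hf.2, h] with y hy hfg
    rwa [← hfg, ← h.self_of_nhds]

theorem IsDiscreteOpenAt.comp_left {f : X → Y} {g : Y → Z} {x : X} (hf : IsDiscreteOpenAt f x)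
    (hinj : Function.Injective g) (hg : 𝓝 (g (f x)) ≤ map g (𝓝 (f x))) :
    IsDiscreteOpenAt (g ∘ f) x :=
  ⟨hg.trans (map_mono hf.1), hf.2.mono fun _ hy hgy => hy (hinj hgy)⟩

theorem IsDiscreteOpenAt.of_comp {f : Y → Z} {χ : X → Y} {x : X}
    (h : IsDiscreteOpenAt (f ∘ χ) x) (hχ : map χ (𝓝 x) = 𝓝 (χ x)) :
    IsDiscreteOpenAt f (χ x) := by
  rw [IsDiscreteOpenAt, ← hχ, Filter.map_map, eventually_map]
  exact ⟨h.1, h.2.mono fun y hy hfy => congrArg χ (hy hfy)⟩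

theorem IsDiscreteOpenOn.mono {f : X → Y} {U V : Set X} (hf : IsDiscreteOpenOn f V)
    (hUV : U ⊆ V) : IsDiscreteOpenOn f U :=
  fun x hx => hf x (hUV hx)

theorem IsDiscreteOpenOn.isOpen_image {f : X → Y} {U : Set X} (hf : IsDiscreteOpenOn f U)
    (hU : IsOpen U) : IsOpen (f '' U) := by
  rw [isOpen_iff_mem_nhds]
  rintro _ ⟨x, hx, rfl⟩
  exact (hf x hx).1 (image_mem_map (hU.mem_nhds hx))

end DiscreteOpen

theorem eventually_eq_or_isDiscreteOpenAt_of_analyticAt {h : ℂ → ℂ} {z : ℂ}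
    (hh : AnalyticAt ℂ h z) : (∀ᶠ w in 𝓝 z, h w = h z) ∨ IsDiscreteOpenAt h z := by
  rcases hh.eventually_constant_or_nhds_le_map_nhds with hc | hopen
  · exact .inl hc
  rcases hh.eventually_eq_or_eventually_ne (analyticAt_const (v := h z)) with hc | hne
  · exact .inl hc
  · refine .inr ⟨hopen, ?_⟩
    filter_upwards [eventually_nhdsWithin_iff.1 hne] with w hw heq
    exact by_contra fun hwz => hw hwz heq

theorem eventually_eq_or_isDiscreteOpenAt_of_chart {g χ : ℂ → RiemannSphere}
    {ψ : RiemannSphere → ℂ} {z w : ℂ} (hψ : Function.LeftInverse ψ χ) (hw : χ w = g z)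
    (hχ : map χ (𝓝 w) = 𝓝 (χ w)) (hc : ContinuousAt g z)
    (hm : MeromorphicAt (fun u => ψ (g u)) z) :
    (∀ᶠ u in 𝓝 z, g u = g z) ∨ IsDiscreteOpenAt g z := by
  have hψw : ψ (g z) = w := by rw [← hw, hψ]
  rw [hw] at hχ
  have hψc : ContinuousAt ψ (g z) := by
    rw [ContinuousAt, ← hχ, hψw, tendsto_map'_iff]
    exact tendsto_id.congr fun u => (hψ u).symm
  have hχψ : ∀ᶠ y in 𝓝 (g z), χ (ψ y) = y := by
    rw [← hχ, eventually_map]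
    exact .of_forall fun u => by rw [hψ]
  have hg : χ ∘ (fun u => ψ (g u)) =ᶠ[𝓝 z] g := hc.eventually hχψ
  rcases eventually_eq_or_isDiscreteOpenAt_of_analyticAt (hm.analyticAt (hψc.comp hc))
    with hconst | hopen
  · left
    filter_upwards [hconst, hg] with u hu hgu
    rw [← hgu, Function.comp_apply, hu, hψw, hw]
  · exact .inr ((hopen.comp_left hψ.injective (by rw [hψw, hw, hχ])).congr hg)

theorem finitePart_coe (z : ℂ) : finitePart (z : RiemannSphere) = z := rfl

theorem infinityChart_zero : infinityChart 0 = OnePoint.infty := by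
  simp [infinityChart]

theorem infinityChart_of_ne_zero {w : ℂ} (hw : w ≠ 0) :
    infinityChart w = ((w⁻¹ : ℂ) : RiemannSphere) := by
  simp [infinityChart, hw]

theorem inv_finitePart_infinityChart (w : ℂ) : (finitePart (infinityChart w))⁻¹ = w := by
  by_cases hw : w = 0
  · rw [hw, infinityChart_zero]
    exact inv_zero
  · rw [infinityChart_of_ne_zero hw, finitePart_coe, inv_inv]

theorem map_infinityChart_nhds_zero : map infinityChart (𝓝 0) = 𝓝 (infinityChart 0) := by
  have h : map infinityChart (𝓝[≠] 0) =
      map (fun z : ℂ => (z : RiemannSphere)) (coclosedCompact ℂ) := by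
    rw [coclosedCompact_eq_cocompact, ← Metric.cobounded_eq_cocompact, ← inv_nhdsNE_zero,
      ← Filter.map_inv, Filter.map_map]
    exact Filter.map_congr (eventually_mem_nhdsWithin.mono fun w hw => infinityChart_of_ne_zero hw)
  rw [infinityChart_zero, OnePoint.nhds_infty_eq, ← h, ← nhdsNE_sup_pure, Filter.map_sup,
    Filter.map_pure, infinityChart_zero]

theorem eventually_eq_or_isDiscreteOpenAt_of_meromorphicAt {g : ℂ → RiemannSphere} {z : ℂ}
    (hc : ContinuousAt g z) (hm : MeromorphicAt (fun w => finitePart (g w)) z) :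
    (∀ᶠ w in 𝓝 z, g w = g z) ∨ IsDiscreteOpenAt g z := by
  by_cases h : g z = OnePoint.infty
  · exact eventually_eq_or_isDiscreteOpenAt_of_chart (ψ := fun y => (finitePart y)⁻¹)
      inv_finitePart_infinityChart (infinityChart_zero.trans h.symm) map_infinityChart_nhds_zero
      hc hm.inv
  · obtain ⟨w, hw⟩ := OnePoint.ne_infty_iff_exists.1 h
    exact eventually_eq_or_isDiscreteOpenAt_of_chart finitePart_coe hw
      (OnePoint.nhds_coe_eq w).symm hc hm

namespace IsMeromorphicOn

variable {f : RiemannSphere → RiemannSphere} {D : Set RiemannSphere}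

theorem continuousAt (hf : IsMeromorphicOn f D) {x : RiemannSphere} (hx : x ∈ D) :
    ContinuousAt f x :=
  hf.continuousOn.continuousAt (hf.isOpen_domain.mem_nhds hx)

theorem eventually_eq_or_isDiscreteOpenAt (hf : IsMeromorphicOn f D) {x : RiemannSphere}
    (hx : x ∈ D) : (∀ᶠ y in 𝓝 x, f y = f x) ∨ IsDiscreteOpenAt f x := by
  have of_chart {χ : ℂ → RiemannSphere} {z : ℂ} (hz : χ z = x) (hχ : map χ (𝓝 z) = 𝓝 (χ z))
      (hm : MeromorphicAt (fun w => finitePart (f (χ w))) z) :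
      (∀ᶠ y in 𝓝 x, f y = f x) ∨ IsDiscreteOpenAt f x := by
    subst hz
    have hc : ContinuousAt (f ∘ χ) z := (hf.continuousAt hx).tendsto.comp hχ.le
    refine (eventually_eq_or_isDiscreteOpenAt_of_meromorphicAt hc hm).imp
      (fun h => ?_) fun h => h.of_comp hχ
    rwa [← hχ, eventually_map]
  induction x using OnePoint.rec with
  | infty =>
    exact of_chart infinityChart_zero map_infinityChart_nhds_zero (hf.meromorphicAt_infty hx)
  | coe z =>
    exact of_chart rfl (OnePoint.nhds_coe_eq z).symm (hf.meromorphicAt_finite z hx)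

theorem not_eventually_eq (hf : IsMeromorphicOn f D) (hn : IsNonconstantOn f D)
    {x : RiemannSphere} (hx : x ∈ D) : ¬ ∀ᶠ y in 𝓝 x, f y = f x := by
  intro h
  obtain ⟨y, hy, hyx⟩ := hn x hx
  -- The points near which `f` equals `f x` form an open set that is also closed in `D`.
  have hsub : connectedComponentIn D x ⊆ {y | ∀ᶠ w in 𝓝 y, f w = f x} := by
    refine isPreconnected_connectedComponentIn.subset_of_closure_inter_subset
      isOpen_setOfPred_eventually_nhds ⟨x, mem_connectedComponentIn hx, h⟩ ?_
    rintro z ⟨hz, hzD⟩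
    replace hzD := connectedComponentIn_subset D x hzD
    have hfreq : ∃ᶠ w in 𝓝 z, ∀ᶠ u in 𝓝 w, f u = f x := mem_closure_iff_frequently.1 hz
    have hfz : f z = f x := by
      by_contra hne
      obtain ⟨w, hw, hw'⟩ :=
        (hfreq.and_eventually ((hf.continuousAt hzD).eventually_ne hne)).exists
      exact hw' hw.self_of_nhds
    rcases hf.eventually_eq_or_isDiscreteOpenAt hzD with hconst | ⟨-, hisolated⟩
    · exact hconst.mono fun w hw => hw.trans hfz
    · obtain ⟨w, hw, hw'⟩ := (hfreq.and_eventually hisolated).exists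
      exact hw' (hw.self_of_nhds.trans hfz.symm) ▸ hw
  exact hyx (hsub hy).self_of_nhds

theorem isDiscreteOpenOn (hf : IsMeromorphicOn f D) (hn : IsNonconstantOn f D) :
    IsDiscreteOpenOn f D :=
  fun _ hx => (hf.eventually_eq_or_isDiscreteOpenAt hx).resolve_left (hf.not_eventually_eq hn hx)

end IsMeromorphicOn

/-! ### Topology of the basic sets -/

theorem subset_image_of_disjoint_image_frontier {X Y : Type*} [TopologicalSpace X]
    [TopologicalSpace Y] [T2Space Y] {f : X → Y} {B : Set X} {V : Set Y}
    (hB : IsCompact (closure B)) (hf : ContinuousOn f (closure B)) (hfB : IsOpen (f '' B))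
    (hV : IsPreconnected V) (hmeet : (V ∩ f '' B).Nonempty)
    (hfr : Disjoint (f '' frontier B) V) : V ⊆ f '' B := by
  refine hV.subset_of_closure_inter_subset hfB hmeet ?_
  rintro y ⟨hy, hyV⟩
  obtain ⟨x, hx, rfl⟩ :=
    closure_minimal (image_mono subset_closure) (hB.image_of_continuousOn hf).isClosed hy
  have hxfr : x ∉ frontier B := fun h => disjoint_left.1 hfr ⟨x, h, rfl⟩ hyV
  rw [closure_eq_self_union_frontier] at hx
  exact ⟨x, hx.resolve_right hxfr, rfl⟩

theorem isOpen_openRect (a b c d : ℚ) : IsOpen (openRect a b c d) := by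
  rw [openRect_eq_image]
  exact OnePoint.isOpen_image_coe.2 (isOpen_Ioo.reProdIm isOpen_Ioo)

theorem isOpen_diskExterior (r : ℚ) : IsOpen (diskExterior r) :=
  OnePoint.isOpen_compl_image_coe.2 ⟨Metric.isClosed_closedBall, isCompact_closedBall _ _⟩

theorem isPreconnected_openRect (a b c d : ℚ) : IsPreconnected (openRect a b c d) := by
  rw [openRect_eq_image]
  have hconv : Convex ℝ (Ioo (a : ℝ) b ×ℂ Ioo (c : ℝ) d) :=
    ((convex_Ioo _ _).linear_preimage Complex.reLm).inter
      ((convex_Ioo _ _).linear_preimage Complex.imLm)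
  exact hconv.isPreconnected.image _ OnePoint.continuous_coe.continuousOn

theorem isPreconnected_setOf_lt_norm {r : ℝ} (hr : 0 < r) : IsPreconnected {z : ℂ | r < ‖z‖} := by
  suffices h : {z : ℂ | r < ‖z‖} = Complex.exp '' {w | Real.log r < w.re} by
    rw [h]
    exact (convex_halfSpace_re_gt _).isPreconnected.image _ Complex.continuous_exp.continuousOn
  ext z
  constructor
  · intro hz
    have hz0 : z ≠ 0 := norm_pos_iff.1 (hr.trans hz)
    exact ⟨Complex.log z, by simpa only [mem_ofPred_eq, Complex.log_re] using Real.log_lt_log hr hz,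
      Complex.exp_log hz0⟩
  · rintro ⟨w, hw, rfl⟩
    rwa [mem_ofPred_eq, Complex.norm_exp, ← Real.log_lt_iff_lt_exp hr]

theorem isPreconnected_diskExterior {r : ℚ} (hr : 0 < r) : IsPreconnected (diskExterior r) := by
  have hfin : diskExterior r ∩ range ((↑) : ℂ → RiemannSphere) =
      (↑) '' {z : ℂ | (r : ℝ) < ‖z‖} := by
    rw [← image_preimage_eq_inter_range]
    congr 1 with z
    exact coe_mem_diskExterior
  have hdense : DenseRange ((↑) : ℂ → RiemannSphere) := OnePoint.denseRange_coe
  refine IsPreconnected.subset_closure ?_ inter_subset_left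
    (hdense.open_subset_closure_inter (isOpen_diskExterior r))
  rw [hfin]
  exact (isPreconnected_setOf_lt_norm (mod_cast hr)).image _ OnePoint.continuous_coe.continuousOn

theorem isOpen_basicOfNat (n : ℕ) : IsOpen (basicOfNat n) := by
  by_cases h : n % 2 = 0
  · rw [basicOfNat_of_even h]; exact isOpen_openRect _ _ _ _
  · rw [basicOfNat_of_not_even h]; exact isOpen_diskExterior _

theorem isPreconnected_basicOfNat (n : ℕ) : IsPreconnected (basicOfNat n) := by
  by_cases h : n % 2 = 0
  · rw [basicOfNat_of_even h]; exact isPreconnected_openRect _ _ _ _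
  · rw [basicOfNat_of_not_even h]; exact isPreconnected_diskExterior (posRatOfNat_pos _)

theorem nonempty_openRect {a b c d : ℚ} (hab : a < b) (hcd : c < d) :
    (openRect a b c d).Nonempty := by
  rw [openRect_eq_image, image_nonempty, Complex.reProdIm_nonempty, nonempty_Ioo, nonempty_Ioo]
  exact ⟨mod_cast hab, mod_cast hcd⟩

theorem nonempty_basicOfNat (n : ℕ) : (basicOfNat n).Nonempty := by
  by_cases h : n % 2 = 0
  · rw [basicOfNat_of_even h]
    exact nonempty_openRect (rectLeft_lt_rectRight _) (rectLower_lt_rectUpper _)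
  · rw [basicOfNat_of_not_even h]; exact ⟨_, infty_mem_diskExterior⟩

theorem isBasic_basicOfNat (n : ℕ) : IsBasic (basicOfNat n) :=
  range_basicOfNat.subset (mem_range_self n)

theorem IsBasic.exists_basicOfNat {S : Set RiemannSphere} (h : IsBasic S) :
    ∃ n, basicOfNat n = S :=
  range_basicOfNat.superset h

/-! ### Grids -/

/-- The number of the rational `(i - 2 (N + 1) ^ 2) / (N + 1)`, a coordinate of the `N`-th grid. -/
def gridCoordinate (N i : ℕ) : ℕ :=
  Nat.pair (Nat.pair i (2 * ((N + 1) * (N + 1)))) N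

/-- The numbers of the cells of the `N`-th grid: for `t = 0` the exterior of the disk of radius
`N + 1`, otherwise overlapping squares of side length `2 / (N + 1)`. -/
def cellCode (N t : ℕ) : ℕ :=
  if t = 0 then 2 * Nat.pair N 0 + 1 else
    2 * Nat.pair (Nat.pair (gridCoordinate N (t - 1).unpair.1) (Nat.pair 1 N))
      (Nat.pair (gridCoordinate N (t - 1).unpair.2) (Nat.pair 1 N))

/-- A number of cells of the `N`-th grid that suffices to cover the sphere. -/
def cellBound (N : ℕ) : ℕ :=
  Nat.pair (4 * ((N + 1) * (N + 1))) (4 * ((N + 1) * (N + 1))) + 1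

@[fun_prop]
theorem primrec_cellCode {α : Type*} [Primcodable α] {N t : α → ℕ} (hN : Primrec N)
    (ht : Primrec t) : Primrec fun a => cellCode (N a) (t a) := by
  unfold cellCode gridCoordinate
  exact Primrec.ite (by fun_prop) (by fun_prop) (by fun_prop)

@[fun_prop]
theorem primrec_cellBound : Primrec cellBound := by unfold cellBound; fun_prop

theorem basicOfNat_cellCode_zero (N : ℕ) :
    basicOfNat (cellCode N 0) = diskExterior (N + 1 : ℕ) := by
  have h : (2 * Nat.pair N 0 + 1) / 2 = Nat.pair N 0 := by omega
  simp [cellCode, basicOfNat, h, posRatOfNat, Nat.add_mod]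

/-- The `N`-th grid, seen in the coordinates of `z` scaled by `N + 1`: there its squares have side
length `2` and integral vertices. -/
theorem coe_mem_basicOfNat_cellCode_succ {N t : ℕ} {z : ℂ} :
    (z : RiemannSphere) ∈ basicOfNat (cellCode N (t + 1)) ↔
      z.re * (N + 1) + 2 * ((N + 1) * (N + 1)) ∈ Ioo (t.unpair.1 : ℝ) (t.unpair.1 + 2) ∧
      z.im * (N + 1) + 2 * ((N + 1) * (N + 1)) ∈ Ioo (t.unpair.2 : ℝ) (t.unpair.2 + 2) := by
  have hN : (0 : ℝ) < N + 1 := by positivity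
  have hcoord (i : ℕ) :
      ratOfNat (gridCoordinate N i) = ((i : ℚ) - 2 * ((N + 1) * (N + 1))) / (N + 1) := by
    simp [ratOfNat, gridCoordinate]
  have hside : posRatOfNat (Nat.pair 1 N) = 2 / (N + 1) := by norm_num [posRatOfNat]
  have hcell : basicOfNat (cellCode N (t + 1)) =
      openRect (ratOfNat (gridCoordinate N t.unpair.1))
        (ratOfNat (gridCoordinate N t.unpair.1) + 2 / (N + 1))
        (ratOfNat (gridCoordinate N t.unpair.2))
        (ratOfNat (gridCoordinate N t.unpair.2) + 2 / (N + 1)) := by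
    simp [cellCode, basicOfNat, rectOfNat, hside]
  have hscale (x : ℝ) (i : ℕ) :
      x ∈ Ioo ((ratOfNat (gridCoordinate N i) : ℚ) : ℝ)
        ((ratOfNat (gridCoordinate N i) + 2 / (N + 1) : ℚ) : ℝ) ↔
      x * (N + 1) + 2 * ((N + 1) * (N + 1)) ∈ Ioo (i : ℝ) (i + 2) := by
    rw [hcoord, mem_Ioo, mem_Ioo]
    push_cast
    rw [← add_div, div_lt_iff₀ hN, lt_div_iff₀ hN]
    constructor <;> rintro ⟨_, _⟩ <;> constructor <;> linarith
  rw [hcell, openRect_eq_image, OnePoint.coe_injective.mem_set_image, Complex.mem_reProdIm,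
    hscale, hscale]

theorem infty_notMem_basicOfNat_cellCode_succ {N t : ℕ} :
    (OnePoint.infty : RiemannSphere) ∉ basicOfNat (cellCode N (t + 1)) := by
  have h : cellCode N (t + 1) % 2 = 0 := by simp [cellCode]
  rw [basicOfNat_of_even h]
  exact infty_notMem_openRect

theorem exists_nat_lt_mem_Ioo_add_two {y : ℝ} {m : ℕ} (hy : 0 < y) (hym : y ≤ m) :
    ∃ i < m, y ∈ Ioo (i : ℝ) (i + 2) := by
  obtain ⟨i, hi⟩ := Nat.exists_eq_succ_of_ne_zero (Nat.ceil_pos.2 hy).ne'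
  have hlt : (i : ℝ) < y := Nat.lt_ceil.1 (by omega)
  have hle : y ≤ (i + 1 : ℕ) := Nat.ceil_le.1 hi.le
  refine ⟨i, mod_cast hlt.trans_le hym, hlt, ?_⟩
  push_cast at hle
  linarith

theorem exists_mem_cell (N : ℕ) (x : RiemannSphere) :
    ∃ t < cellBound N, x ∈ basicOfNat (cellCode N t) := by
  by_cases hx : x ∈ basicOfNat (cellCode N 0)
  · exact ⟨0, Nat.succ_pos _, hx⟩
  rw [basicOfNat_cellCode_zero] at hx
  induction x using OnePoint.rec with
  | infty => exact absurd infty_mem_diskExterior hx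
  | coe z =>
    rw [coe_mem_diskExterior, not_lt] at hx
    push_cast at hx
    have hindex {s : ℝ} (hs : |s| ≤ ‖z‖) : ∃ i < 4 * ((N + 1) * (N + 1)),
        s * (N + 1) + 2 * ((N + 1) * (N + 1)) ∈ Ioo (i : ℝ) (i + 2) := by
      have : (0 : ℝ) < N + 1 := by positivity
      obtain ⟨hlow, hupp⟩ := abs_le.1 (hs.trans hx)
      apply exists_nat_lt_mem_Ioo_add_two
      · nlinarith
      · push_cast; nlinarith
    obtain ⟨i, hi, hre⟩ := hindex (Complex.abs_re_le_norm z)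
    obtain ⟨j, hj, him⟩ := hindex (Complex.abs_im_le_norm z)
    refine ⟨Nat.pair i j + 1, Nat.succ_lt_succ
      ((Nat.pair_lt_pair_left _ hi).trans (Nat.pair_lt_pair_right _ hj)), ?_⟩
    rw [coe_mem_basicOfNat_cellCode_succ, Nat.unpair_pair]
    exact ⟨hre, him⟩

theorem dist_lt_of_mem_cell {N t : ℕ} {z w : ℂ}
    (hz : (z : RiemannSphere) ∈ basicOfNat (cellCode N (t + 1)))
    (hw : (w : RiemannSphere) ∈ basicOfNat (cellCode N (t + 1))) : dist z w < 4 / (N + 1) := by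
  have hN : (0 : ℝ) < N + 1 := by positivity
  rw [coe_mem_basicOfNat_cellCode_succ] at hz hw
  have hcoord {x y c i : ℝ} (hx : x * (N + 1) + c ∈ Ioo i (i + 2))
      (hy : y * (N + 1) + c ∈ Ioo i (i + 2)) : |x - y| < 2 / (N + 1) := by
    rw [abs_lt, neg_lt, lt_div_iff₀ hN, lt_div_iff₀ hN]
    constructor <;> linarith [hx.1, hx.2, hy.1, hy.2]
  calc dist z w ≤ |(z - w).re| + |(z - w).im| := by
        rw [dist_eq_norm]; exact Complex.norm_le_abs_re_add_abs_im _
    _ < 2 / (N + 1) + 2 / (N + 1) := add_lt_add (hcoord hz.1 hw.1) (hcoord hz.2 hw.2)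
    _ = 4 / (N + 1) := by ring

theorem exists_diskExterior_natCast_subset {W : Set RiemannSphere} (hW : W ∈ 𝓝 OnePoint.infty) :
    ∃ n : ℕ, diskExterior n ⊆ W := by
  obtain ⟨s, ⟨-, hs⟩, hsW⟩ := OnePoint.hasBasis_nhds_infty.mem_iff.1 hW
  obtain ⟨ρ, hρ⟩ := hs.isBounded.subset_closedBall 0
  obtain ⟨n, hn⟩ := exists_nat_ge ρ
  refine ⟨n, fun x hx => hsW ?_⟩
  induction x using OnePoint.rec with
  | infty => exact Or.inr rfl
  | coe z =>
    rw [coe_mem_diskExterior, Rat.cast_natCast] at hx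
    exact Or.inl ⟨z, fun hzs => (mem_closedBall_zero_iff.1 (hρ hzs)).not_gt (hn.trans_lt hx), rfl⟩

theorem eventually_cell_subset_infty {W : Set RiemannSphere} (hW : W ∈ 𝓝 OnePoint.infty) :
    ∀ᶠ y : ℕ × RiemannSphere in atTop ×ˢ 𝓝 OnePoint.infty,
      ∀ t, y.2 ∈ basicOfNat (cellCode y.1 t) → basicOfNat (cellCode y.1 t) ⊆ W := by
  obtain ⟨n, hn⟩ := exists_diskExterior_natCast_subset hW
  have hfar : ∀ᶠ y in 𝓝 (OnePoint.infty : RiemannSphere), y ∈ diskExterior (n + 4) :=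
    (isOpen_diskExterior _).mem_nhds infty_mem_diskExterior
  filter_upwards [(eventually_ge_atTop n).prod_mk hfar]
  rintro ⟨N, y⟩ ⟨hN, hy⟩ t hyt
  refine Subset.trans ?_ hn
  cases t with
  | zero =>
    rw [basicOfNat_cellCode_zero, diskExterior_subset_diskExterior_iff (by positivity)]
    exact_mod_cast (show n ≤ N from hN).trans N.le_succ
  | succ t =>
    intro x hx
    induction y using OnePoint.rec with
    | infty => exact absurd hyt infty_notMem_basicOfNat_cellCode_succ
    | coe w =>
      induction x using OnePoint.rec with
      | infty => exact absurd hx infty_notMem_basicOfNat_cellCode_succ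
      | coe z =>
        rw [coe_mem_diskExterior] at hy ⊢
        push_cast at hy ⊢
        have hdist := dist_lt_of_mem_cell hyt hx
        have hside : (4 : ℝ) / (N + 1) ≤ 4 := div_le_self (by norm_num) (by simp)
        have htri := norm_sub_norm_le w z
        rw [← dist_eq_norm] at htri
        linarith

theorem eventually_cell_subset_coe {z : ℂ} {W : Set RiemannSphere}
    (hW : W ∈ 𝓝 (z : RiemannSphere)) :
    ∀ᶠ y : ℕ × RiemannSphere in atTop ×ˢ 𝓝 (z : RiemannSphere),
      ∀ t, y.2 ∈ basicOfNat (cellCode y.1 t) → basicOfNat (cellCode y.1 t) ⊆ W := by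
  rw [OnePoint.nhds_coe_eq, mem_map, Metric.mem_nhds_iff] at hW
  obtain ⟨ε, hε, hεW⟩ := hW
  rw [OnePoint.nhds_coe_eq, prod_map_right, eventually_map]
  have hside : Tendsto (fun N : ℕ => 4 / ((N : ℝ) + 1)) atTop (𝓝 0) :=
    tendsto_const_nhds.div_atTop (tendsto_atTop_add_const_right _ _ tendsto_natCast_atTop_atTop)
  have hsmall : ∀ᶠ y : ℕ × ℂ in atTop ×ˢ 𝓝 z, 4 / ((y.1 : ℝ) + 1) < ε / 2 ∧ ‖z‖ + ε ≤ y.1 :=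
    ((hside.eventually_lt_const (half_pos hε)).and
      (tendsto_natCast_atTop_atTop.eventually_ge_atTop _)).prod_inl _
  have hnear : ∀ᶠ w in 𝓝 z, dist w z < ε / 2 := Metric.ball_mem_nhds z (half_pos hε)
  filter_upwards [hsmall, hnear.prod_inr _]
  rintro ⟨N, w⟩ ⟨hN, hzN⟩ hw t hwt
  simp only [Prod.map_apply, id_eq] at hN hzN hw hwt ⊢
  cases t with
  | zero =>
    rw [basicOfNat_cellCode_zero, coe_mem_diskExterior] at hwt
    push_cast at hwt
    have htri := norm_sub_norm_le w z
    rw [← dist_eq_norm] at htri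
    linarith [hw]
  | succ t =>
    intro x hx
    induction x using OnePoint.rec with
    | infty => exact absurd hx infty_notMem_basicOfNat_cellCode_succ
    | coe u =>
      refine hεW (Metric.mem_ball.2 ?_)
      linarith [dist_triangle u w z, dist_lt_of_mem_cell hx hwt, hw]

theorem eventually_cell_subset {x : RiemannSphere} {W : Set RiemannSphere} (hW : W ∈ 𝓝 x) :
    ∀ᶠ y : ℕ × RiemannSphere in atTop ×ˢ 𝓝 x,
      ∀ t, y.2 ∈ basicOfNat (cellCode y.1 t) → basicOfNat (cellCode y.1 t) ⊆ W := by
  induction x using OnePoint.rec with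
  | infty => exact eventually_cell_subset_infty hW
  | coe z => exact eventually_cell_subset_coe hW

/-- The filter on the numbers of basic sets whose events hold for all basic sets inside some
neighborhood of `x` (whether or not these sets contain `x`). -/
noncomputable def smallBasic (x : RiemannSphere) : Filter ℕ :=
  comap basicOfNat (𝓝 x).smallSets

theorem eventually_smallBasic {x : RiemannSphere} {G : ℕ → Prop} :
    (∀ᶠ c in smallBasic x, G c) ↔ ∃ W ∈ 𝓝 x, ∀ c, basicOfNat c ⊆ W → G c := by
  simp only [smallBasic, eventually_comap, eventually_smallSets]
  exact exists_congr fun W => and_congr_right fun _ =>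
    ⟨fun h c hc => h _ hc c rfl, fun h S hS c hc => h c (hc ▸ hS)⟩

theorem eventually_smallBasic_subset {x : RiemannSphere} {W : Set RiemannSphere} (hW : W ∈ 𝓝 x) :
    ∀ᶠ c in smallBasic x, basicOfNat c ⊆ W :=
  eventually_smallBasic.2 ⟨W, hW, fun _ => id⟩

theorem exists_mem_of_eventually_smallBasic {x : RiemannSphere} {G : ℕ → Prop}
    (h : ∀ᶠ c in smallBasic x, G c) : ∃ c, x ∈ basicOfNat c ∧ G c := by
  obtain ⟨W, hW, hG⟩ := eventually_smallBasic.1 h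
  obtain ⟨N, hN⟩ := (eventually_cell_subset hW).curry.exists
  obtain ⟨t, -, ht⟩ := exists_mem_cell N x
  exact ⟨_, ht, hG _ (hN.self_of_nhds t ht)⟩

theorem eventually_smallBasic_disjoint {x : RiemannSphere} {S : Set RiemannSphere}
    (hx : x ∉ closure S) : ∀ᶠ c in smallBasic x, Disjoint (basicOfNat c) S :=
  (eventually_smallBasic_subset (isClosed_closure.isOpen_compl.mem_nhds hx)).mono fun _ hc =>
    (disjoint_compl_left.mono_left hc).mono_right subset_closure

theorem exists_closure_basicOfNat_subset {x : RiemannSphere} {W : Set RiemannSphere}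
    (hW : W ∈ 𝓝 x) : ∃ k, x ∈ basicOfNat k ∧ closure (basicOfNat k) ⊆ W := by
  obtain ⟨V, hV, hVc, hVW⟩ := exists_mem_nhds_isClosed_subset hW
  obtain ⟨k, hk, hkV⟩ := exists_mem_of_eventually_smallBasic (eventually_smallBasic_subset hV)
  exact ⟨k, hk, (closure_minimal hkV hVc).trans hVW⟩

theorem exists_forall_cell {G : ℕ → Prop} (hG : ∀ x, ∀ᶠ c in smallBasic x, G c) :
    ∃ N, ∀ t, G (cellCode N t) := by
  have hlocal (x : RiemannSphere) : ∀ᶠ y : ℕ × RiemannSphere in atTop ×ˢ 𝓝 x,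
      ∀ t, y.2 ∈ basicOfNat (cellCode y.1 t) → G (cellCode y.1 t) := by
    obtain ⟨W, hW, hWG⟩ := eventually_smallBasic.1 (hG x)
    exact (eventually_cell_subset hW).mono fun y hy t ht => hWG _ (hy t ht)
  have hglobal := isCompact_univ.mem_prod_nhdsSet_of_forall fun x _ => hlocal x
  rw [nhdsSet_univ] at hglobal
  obtain ⟨N, hN⟩ := (Eventually.curry hglobal).exists
  refine ⟨N, fun t => ?_⟩
  obtain ⟨x, hx⟩ := nonempty_basicOfNat (cellCode N t)
  exact eventually_top.1 hN x t hx

/-- A finite certificate that the closure of the basic set with the number `k` is covered by basic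
sets with the property `G`: the cells of some grid either avoid that set or satisfy `G`. -/
def HoldsOnGrid (k : ℕ) (G : ℕ → Prop) : Prop :=
  ∃ N, ∀ t < cellBound N, Disjoint (basicOfNat (cellCode N t)) (basicOfNat k) ∨ G (cellCode N t)

theorem HoldsOnGrid.exists_mem {k : ℕ} {G : ℕ → Prop} (h : HoldsOnGrid k G) {x : RiemannSphere}
    (hx : x ∈ closure (basicOfNat k)) : ∃ c, x ∈ basicOfNat c ∧ G c := by
  obtain ⟨N, hN⟩ := h
  obtain ⟨t, ht, hxt⟩ := exists_mem_cell N x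
  refine ⟨_, hxt, (hN t ht).resolve_left fun hdisj => ?_⟩
  exact disjoint_left.1 (hdisj.closure_right (isOpen_basicOfNat _)) hxt hx

theorem holdsOnGrid_of_eventually {k : ℕ} {G : ℕ → Prop}
    (h : ∀ x ∈ closure (basicOfNat k), ∀ᶠ c in smallBasic x, G c) : HoldsOnGrid k G := by
  obtain ⟨N, hN⟩ := exists_forall_cell
      (G := fun c => Disjoint (basicOfNat c) (basicOfNat k) ∨ G c) fun x => by
    by_cases hx : x ∈ closure (basicOfNat k)
    · exact (h x hx).mono fun _ => Or.inr
    · exact (eventually_smallBasic_disjoint hx).mono fun _ => Or.inl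
  exact ⟨N, fun t _ => hN t⟩

/-! ### Certificates for images -/

/-- The list `l` is an initial segment of a tape that can be presented to the machine named by `A`
for every point of the basic set with the number `c`: a list of basic sets around that set in the
even cells, and the oracle in the odd ones. Here, as in the following definitions, `A` is a function
name in the even cells, with the code of the machine in the cell `0`, joined with an open name in
the odd ones. -/
def IsCommonTapePrefix (A : ℕ → ℕ) (c : ℕ) (l : List ℕ) : Prop :=
  ∀ i < l.length,
    i % 2 = 0 ∧ (l.getD i 0 = 0 ∨ basicOfNat c ⊆ basicOfNat (l.getD i 0 - 1)) ∨
      i % 2 = 1 ∧ A (i + 1) = l.getD i 0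

/-- A certificate that the function named by `A` maps the basic set with the number `c` into the
one with the number `v`: the machine lists `v` after having read only symbols that are possible for
all points of `c`. -/
def MapsBasic (A : ℕ → ℕ) (c v : ℕ) : Prop :=
  ∃ l n, IsCommonTapePrefix A c l ∧
    v + 1 ∈ (OracleCode.simulateNat (A 0)).eval (Nat.pair (Encodable.encode l) n)

/-- The basic set with the number `r` is listed in the odd cells of `A`. -/
def ListsBasic (A : ℕ → ℕ) (r : ℕ) : Prop :=
  ∃ n, A (2 * n + 1) = r + 1

/-- A certificate that the basic set with the number `v` is contained in the image: it meets the
image of a listed basic set `r`, and is disjoint from the image of the frontier of `r`. -/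
def ImageContainsBasic (A : ℕ → ℕ) (v : ℕ) : Prop :=
  ∃ r, ListsBasic A r ∧ (∃ c, basicOfNat c ⊆ basicOfNat r ∧ MapsBasic A c v) ∧
    HoldsOnGrid r fun c => basicOfNat c ⊆ basicOfNat r ∨
      ∃ v', MapsBasic A c v' ∧ Disjoint (basicOfNat v') (basicOfNat v)

/-- A certificate that the closure of the basic set with the number `k` is contained in the
image. -/
def ImageCoversBasic (A : ℕ → ℕ) (k : ℕ) : Prop :=
  HoldsOnGrid k fun c => ∃ v, ImageContainsBasic A v ∧ basicOfNat c ⊆ basicOfNat v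

namespace OracleSemidecidable

variable {α : Type*} [Primcodable α] {c k v : α → ℕ}

theorem holdsOnGrid {G : (ℕ → ℕ) → α → ℕ → Prop}
    (hG : ∀ g : (α × ℕ) × ℕ → ℕ, Primrec g → OracleSemidecidable fun A x => G A x.1.1 (g x))
    (hk : Primrec k) : OracleSemidecidable fun A a => HoldsOnGrid (k a) (G A a) :=
  exists_denumerable <| forall_lt (or (of_primrecPred (by fun_prop)) (hG _ (by fun_prop)))
    (by fun_prop)

theorem isCommonTapePrefix {l : α → List ℕ} (hc : Primrec c) (hl : Primrec l) :
    OracleSemidecidable fun A a => IsCommonTapePrefix A (c a) (l a) :=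
  forall_lt (or (of_primrecPred (by fun_prop))
    (and (of_primrecPred (by fun_prop)) (oracle_eq (by fun_prop) (by fun_prop)))) (by fun_prop)

theorem mapsBasic (hc : Primrec c) (hv : Primrec v) :
    OracleSemidecidable fun A a => MapsBasic A (c a) (v a) := by
  have h : OracleSemidecidable fun A a => ∃ l n e, A 0 = e ∧ IsCommonTapePrefix A (c a) l ∧
      v a + 1 ∈ (OracleCode.simulateNat e).eval (Nat.pair (Encodable.encode l) n) :=
    exists_denumerable <| exists_denumerable <| exists_denumerable <|
      and (oracle_eq (by fun_prop) (by fun_prop)) <|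
        and (isCommonTapePrefix (by fun_prop) (by fun_prop))
          (mem_eval (by fun_prop) (by fun_prop) (by fun_prop))
  exact h.of_iff fun A a => by simp only [MapsBasic, exists_eq_left']

theorem listsBasic (hv : Primrec v) : OracleSemidecidable fun A a => ListsBasic A (v a) :=
  exists_denumerable (oracle_eq (by fun_prop) (by fun_prop))

theorem imageContainsBasic (hv : Primrec v) :
    OracleSemidecidable fun A a => ImageContainsBasic A (v a) :=
  exists_denumerable <| and (listsBasic (by fun_prop)) <| and
    (exists_denumerable <| and (of_primrecPred (by fun_prop))
      (mapsBasic (by fun_prop) (by fun_prop)))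
    (holdsOnGrid (fun g hg => or (of_primrecPred (by fun_prop)) <| exists_denumerable <|
      and (mapsBasic (by fun_prop) (by fun_prop)) (of_primrecPred (by fun_prop))) (by fun_prop))

theorem imageCoversBasic : OracleSemidecidable ImageCoversBasic :=
  holdsOnGrid (fun g hg => exists_denumerable <|
    and (imageContainsBasic (by fun_prop)) (of_primrecPred (by fun_prop))) (by fun_prop)

end OracleSemidecidable

/-! ### Finite information about names -/

theorem listedSets_eq_iff {p : ℕ → ℕ} {P : Set RiemannSphere → Prop} :
    listedSets p = {S | IsBasic S ∧ P S} ↔ (∀ n k, p n = k + 1 → P (basicOfNat k)) ∧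
      ∀ k, P (basicOfNat k) → ∃ n v, p n = v + 1 ∧ basicOfNat v = basicOfNat k := by
  refine ⟨fun h => ⟨fun n k hk => ?_, fun k hk => ?_⟩, fun h => Set.ext fun S => ⟨?_, ?_⟩⟩
  · exact (h.subset ⟨n, k, hk, rfl⟩).2
  · exact h.superset ⟨isBasic_basicOfNat k, hk⟩
  · rintro ⟨n, k, hk, rfl⟩
    exact ⟨isBasic_basicOfNat k, h.1 n k hk⟩
  · rintro ⟨hS, hPS⟩
    obtain ⟨k, rfl⟩ := hS.exists_basicOfNat
    exact h.2 k hPS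

theorem exists_isPointName_eq_of_lt {z : RiemannSphere} {L : ℕ → ℕ} {m : ℕ}
    (hL : ∀ j < m, ∀ k, L j = k + 1 → z ∈ basicOfNat k) :
    ∃ p, IsPointName p z ∧ ∀ j < m, p j = L j := by
  classical
  refine ⟨fun j => if j < m then L j else if z ∈ basicOfNat (j - m) then j - m + 1 else 0,
    listedSets_eq_iff.2 ⟨fun j k hk => ?_, fun k hk => ⟨k + m, k, ?_, rfl⟩⟩, fun j hj => if_pos hj⟩
  · split_ifs at hk with hj hz
    · exact hL j hj k hk
    · rwa [← Nat.succ_injective hk]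
  · simp [hk]

theorem IsFunctionName.mono {X : Set ℕ} {e : OracleCode} {f : RiemannSphere → RiemannSphere}
    {D U : Set RiemannSphere} (h : IsFunctionName X e f D) (hUD : U ⊆ D) :
    IsFunctionName X e f U :=
  fun z hz => h z (hUD hz)

theorem tapeJoin_of_even {p q : ℕ → ℕ} {i : ℕ} (hi : i % 2 = 0) : tapeJoin p q i = p (i / 2) :=
  if_pos hi

theorem tapeJoin_of_odd {p q : ℕ → ℕ} {i : ℕ} (hi : i % 2 = 1) : tapeJoin p q i = q (i / 2) :=
  if_neg (by omega)

theorem tapeJoin_two_mul_add_one (p q : ℕ → ℕ) (n : ℕ) : tapeJoin p q (2 * n + 1) = q n := by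
  rw [tapeJoin_of_odd (by omega), show (2 * n + 1) / 2 = n by omega]

theorem tapeJoin_functionNameSeq_succ {X : Set ℕ} {e : OracleCode} {i : ℕ} (hi : i % 2 = 1)
    (a p : ℕ → ℕ) : tapeJoin (functionNameSeq X e) p (i + 1) = tapeJoin a (charSeq X) i := by
  rw [tapeJoin_of_even (by omega), tapeJoin_of_odd hi, show (i + 1) / 2 = i / 2 + 1 by omega,
    functionNameSeq]

theorem ListsBasic.closure_subset {U : Set RiemannSphere} {a p : ℕ → ℕ} {r : ℕ}
    (h : ListsBasic (tapeJoin a p) r) (hp : IsOpenName p U) : closure (basicOfNat r) ⊆ U := by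
  obtain ⟨n, hn⟩ := h
  rw [tapeJoin_two_mul_add_one] at hn
  exact (listedSets_eq_iff.1 hp).1 n r hn

theorem IsOpenName.exists_listsBasic {U : Set RiemannSphere} {p : ℕ → ℕ} (hp : IsOpenName p U)
    (a : ℕ → ℕ) {k : ℕ} (h : closure (basicOfNat k) ⊆ U) :
    ∃ r, basicOfNat r = basicOfNat k ∧ ListsBasic (tapeJoin a p) r := by
  obtain ⟨n, r, hn, hr⟩ := (listedSets_eq_iff.1 hp).2 k h
  exact ⟨r, hr, n, by rw [tapeJoin_two_mul_add_one, hn]⟩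

section FunctionName

variable {X : Set ℕ} {e : OracleCode} {f : RiemannSphere → RiemannSphere} {U : Set RiemannSphere}
  {p : ℕ → ℕ} {z : RiemannSphere}

theorem IsCommonTapePrefix.exists_isPointName {c : ℕ} {l : List ℕ}
    (h : IsCommonTapePrefix (tapeJoin (functionNameSeq X e) p) c l) (hz : z ∈ basicOfNat c) :
    ∃ a, IsPointName a z ∧ ∀ i < l.length, tapeJoin a (charSeq X) i = l.getD i 0 := by
  have hlisted : ∀ j < l.length, ∀ k, l.getD (2 * j) 0 = k + 1 → z ∈ basicOfNat k := by
    intro j _ k hk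
    have hj : 2 * j < l.length := by
      by_contra hj
      rw [List.getD_eq_default l 0 (not_lt.1 hj)] at hk
      exact absurd hk (by simp)
    rcases h (2 * j) hj with ⟨-, hblank | hsub⟩ | ⟨hodd, -⟩
    · omega
    · rw [hk] at hsub
      exact hsub hz
    · omega
  obtain ⟨a, ha, hal⟩ := exists_isPointName_eq_of_lt hlisted
  refine ⟨a, ha, fun i hi => ?_⟩
  rcases h i hi with ⟨heven, -⟩ | ⟨hodd, hA⟩
  · rw [tapeJoin_of_even heven, hal _ (by omega), Nat.mul_div_cancel' (by omega)]
  · rw [← tapeJoin_functionNameSeq_succ hodd a p, hA]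

theorem MapsBasic.apply_mem {c v : ℕ} (h : MapsBasic (tapeJoin (functionNameSeq X e) p) c v)
    (hname : IsFunctionName X e f U) (hzU : z ∈ U) (hz : z ∈ basicOfNat c) :
    f z ∈ basicOfNat v := by
  obtain ⟨l, n, hl, hv⟩ := h
  obtain ⟨a, ha, hal⟩ := hl.exists_isPointName hz
  obtain ⟨q, hq, hqf⟩ := hname z hzU a ha
  refine (listedSets_eq_iff.1 hqf).1 n v (Part.mem_unique (hq n) ?_)
  change v + 1 ∈ (OracleCode.simulateNat e.toNat).eval _ at hv
  rw [OracleCode.simulateNat_toNat, OracleCode.eval_simulate] at hv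
  rw [← OracleCode.evalPart_coe]
  refine OracleCode.mem_evalPart_mono (fun i w hw => ?_) e hv
  obtain ⟨hi, rfl⟩ := List.getElem?_eq_some_iff.1 (OracleCode.mem_listOracle.1 hw)
  rw [← List.getD_eq_getElem l 0 hi, ← hal i hi]
  exact Part.mem_some _

theorem IsPointName.eventually_isCommonTapePrefix {a : ℕ → ℕ} (ha : IsPointName a z) (m : ℕ) :
    ∀ᶠ c in smallBasic z, IsCommonTapePrefix (tapeJoin (functionNameSeq X e) p) c
      (oraclePrefix (tapeJoin a (charSeq X)) m) := by
  simp only [IsCommonTapePrefix, length_oraclePrefix]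
  refine (eventually_all_finite (finite_lt_nat m)).2 fun i (hi : i < m) => ?_
  have hget : (oraclePrefix (tapeJoin a (charSeq X)) m).getD i 0 = tapeJoin a (charSeq X) i := by
    simp [List.getD, oraclePrefix_getElem?_eq_some.2 ⟨hi, rfl⟩]
  simp only [hget]
  rcases Nat.mod_two_eq_zero_or_one i with heven | hodd
  · rw [tapeJoin_of_even heven]
    rcases hk : a (i / 2) with - | k
    · exact .of_forall fun c => .inl ⟨heven, .inl rfl⟩
    · have hz := (listedSets_eq_iff.1 ha).1 _ k hk
      exact (eventually_smallBasic_subset ((isOpen_basicOfNat k).mem_nhds hz)).mono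
        fun c hc => .inl ⟨heven, .inr hc⟩
  · exact .of_forall fun c => .inr ⟨hodd, tapeJoin_functionNameSeq_succ hodd a p⟩

theorem eventually_mem_listOracle_oraclePrefix (A : ℕ → ℕ) (i v : ℕ) (hv : v ∈ (A : ℕ →. ℕ) i) :
    ∀ᶠ m in atTop, v ∈ OracleCode.listOracle (oraclePrefix A m) i := by
  obtain rfl := Part.mem_some_iff.1 hv
  filter_upwards [eventually_gt_atTop i] with m hm
  exact OracleCode.mem_listOracle.2 (oraclePrefix_getElem?_eq_some.2 ⟨hm, rfl⟩)

theorem IsFunctionName.exists_eventually_mapsBasic (hname : IsFunctionName X e f U) (p : ℕ → ℕ)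
    (hz : z ∈ U) {k : ℕ} (hk : f z ∈ basicOfNat k) :
    ∃ v, basicOfNat v = basicOfNat k ∧
      ∀ᶠ c in smallBasic z, MapsBasic (tapeJoin (functionNameSeq X e) p) c v := by
  obtain ⟨a, ha, -⟩ := exists_isPointName_eq_of_lt (z := z) (L := 0) (m := 0) (by simp)
  obtain ⟨q, hq, hqf⟩ := hname z hz a ha
  obtain ⟨n, v, hv, hvk⟩ := (listedSets_eq_iff.1 hqf).2 k hk
  refine ⟨v, hvk, ?_⟩
  have hrun : v + 1 ∈ e.evalPart (tapeJoin a (charSeq X)) n := by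
    rw [OracleCode.evalPart_coe, ← hv]
    exact hq n
  obtain ⟨m, hm⟩ := (OracleCode.eventually_mem_evalPart
    (eventually_mem_listOracle_oraclePrefix _) e hrun).exists
  refine (ha.eventually_isCommonTapePrefix m).mono fun c hc => ⟨_, n, hc, ?_⟩
  change v + 1 ∈ (OracleCode.simulateNat e.toNat).eval _
  rwa [OracleCode.simulateNat_toNat, OracleCode.eval_simulate]

theorem IsFunctionName.continuousOn (hname : IsFunctionName X e f U) : ContinuousOn f U := by
  intro z hz W hW
  obtain ⟨k, hk, hkW⟩ := exists_closure_basicOfNat_subset hW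
  obtain ⟨v, hvk, hv⟩ := hname.exists_eventually_mapsBasic 0 hz hk
  obtain ⟨c, hzc, hc⟩ := exists_mem_of_eventually_smallBasic hv
  refine mem_nhdsWithin.2 ⟨_, isOpen_basicOfNat c, hzc, fun x hx => hkW (subset_closure ?_)⟩
  rw [← hvk]
  exact hc.apply_mem hname hx.2 hx.1

/-! ### Correctness -/

theorem ImageContainsBasic.subset_image {v : ℕ}
    (h : ImageContainsBasic (tapeJoin (functionNameSeq X e) p) v) (hf : IsDiscreteOpenOn f U)
    (hname : IsFunctionName X e f U) (hp : IsOpenName p U) : basicOfNat v ⊆ f '' U := by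
  obtain ⟨r, hr, ⟨c, hcr, hcv⟩, hgrid⟩ := h
  have hrU := hr.closure_subset hp
  refine (subset_image_of_disjoint_image_frontier isClosed_closure.isCompact
    (hname.continuousOn.mono hrU)
    ((hf.mono (subset_closure.trans hrU)).isOpen_image (isOpen_basicOfNat r))
    (isPreconnected_basicOfNat v) ?_ ?_).trans (image_mono (subset_closure.trans hrU))
  · obtain ⟨z, hz⟩ := nonempty_basicOfNat c
    exact ⟨f z, hcv.apply_mem hname (hrU (subset_closure (hcr hz))) hz, mem_image_of_mem f (hcr hz)⟩
  · rw [(isOpen_basicOfNat r).frontier_eq, disjoint_left]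
    rintro _ ⟨x, ⟨hx, hxr⟩, rfl⟩
    obtain ⟨c', hxc', hsub | ⟨v', hv', hdisj⟩⟩ := hgrid.exists_mem hx
    · exact absurd (hsub hxc') hxr
    · exact disjoint_left.1 hdisj (hv'.apply_mem hname (hrU hx) hxc')

theorem exists_imageContainsBasic (hf : IsDiscreteOpenOn f U) (hname : IsFunctionName X e f U)
    (hU : IsOpen U) (hp : IsOpenName p U) (hz : z ∈ U) :
    ∃ v, ImageContainsBasic (tapeJoin (functionNameSeq X e) p) v ∧ f z ∈ basicOfNat v := by
  obtain ⟨k, hzk, hk⟩ := exists_closure_basicOfNat_subset (inter_mem (hU.mem_nhds hz) (hf z hz).2)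
  obtain ⟨r, hrk, hr⟩ := hp.exists_listsBasic (functionNameSeq X e) (hk.trans inter_subset_left)
  rw [← hrk] at hzk hk
  obtain ⟨hrU, hfibre⟩ := subset_inter_iff.1 hk
  have hclosed : IsClosed (f '' frontier (basicOfNat r)) :=
    (isClosed_frontier.isCompact.image_of_continuousOn
      (hname.continuousOn.mono (frontier_subset_closure.trans hrU))).isClosed
  have hzfr : f z ∉ f '' frontier (basicOfNat r) := by
    rintro ⟨x, hx, hxz⟩
    obtain rfl : x = z := hfibre (frontier_subset_closure hx) hxz
    rw [(isOpen_basicOfNat r).frontier_eq] at hx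
    exact hx.2 hzk
  obtain ⟨j, hzj, hj⟩ := exists_closure_basicOfNat_subset (hclosed.isOpen_compl.mem_nhds hzfr)
  obtain ⟨v, hvj, hv⟩ := hname.exists_eventually_mapsBasic p hz hzj
  rw [← hvj] at hzj hj
  refine ⟨v, ⟨r, hr, ?_, holdsOnGrid_of_eventually fun x hx => ?_⟩, hzj⟩
  · obtain ⟨c, -, hc⟩ := exists_mem_of_eventually_smallBasic
      ((eventually_smallBasic_subset ((isOpen_basicOfNat r).mem_nhds hzk)).and hv)
    exact ⟨c, hc⟩
  · by_cases hxr : x ∈ basicOfNat r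
    · exact (eventually_smallBasic_subset ((isOpen_basicOfNat r).mem_nhds hxr)).mono fun _ => .inl
    · have hfx : f x ∉ closure (basicOfNat v) := fun h =>
        hj h ⟨x, (isOpen_basicOfNat r).frontier_eq ▸ ⟨hx, hxr⟩, rfl⟩
      obtain ⟨i, hi, hdisj⟩ :=
        exists_mem_of_eventually_smallBasic (eventually_smallBasic_disjoint hfx)
      obtain ⟨v', hv'i, hv'⟩ := hname.exists_eventually_mapsBasic p (hrU hx) hi
      exact hv'.mono fun c hc => .inr ⟨v', hc, hv'i ▸ hdisj⟩

theorem imageCoversBasic_iff (hf : IsDiscreteOpenOn f U) (hname : IsFunctionName X e f U)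
    (hU : IsOpen U) (hp : IsOpenName p U) {k : ℕ} :
    ImageCoversBasic (tapeJoin (functionNameSeq X e) p) k ↔ closure (basicOfNat k) ⊆ f '' U := by
  refine ⟨fun h y hy => ?_, fun h => holdsOnGrid_of_eventually fun y hy => ?_⟩
  · obtain ⟨c, hyc, v, hv, hcv⟩ := h.exists_mem hy
    exact hv.subset_image hf hname hp (hcv hyc)
  · obtain ⟨z, hz, rfl⟩ := h hy
    obtain ⟨v, hv, hzv⟩ := exists_imageContainsBasic hf hname hU hp hz
    exact (eventually_smallBasic_subset ((isOpen_basicOfNat v).mem_nhds hzv)).mono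
      fun c hc => ⟨v, hv, hc⟩

end FunctionName

theorem mainTheorem8_general :
    ∃ M : OracleCode, ∀ (f : RiemannSphere → RiemannSphere) (U : Set RiemannSphere),
      IsOpen U → IsDiscreteOpenOn f U →
      ∀ (X : Set ℕ) (e : OracleCode), IsFunctionName X e f U →
      ∀ p : ℕ → ℕ, IsOpenName p U →
        IsOpen (f '' U) ∧
          ∃ q : ℕ → ℕ, M.Computes (tapeJoin (functionNameSeq X e) p) q ∧
            IsOpenName q (f '' U) := by
  obtain ⟨M, hM⟩ := OracleSemidecidable.imageCoversBasic.exists_machine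
  refine ⟨M, fun f U hU hf X e hname p hp => ⟨hf.isOpen_image hU, ?_⟩⟩
  obtain ⟨q, hq, hqk⟩ := hM (tapeJoin (functionNameSeq X e) p)
  refine ⟨q, hq, listedSets_eq_iff.2 ⟨fun n k hk => ?_, fun k hk => ?_⟩⟩
  · exact (imageCoversBasic_iff hf hname hU hp).1 ((hqk k).2 ⟨n, hk⟩)
  · obtain ⟨n, hn⟩ := (hqk k).1 ((imageCoversBasic_iff hf hname hU hp).2 hk)
    exact ⟨n, k, hn, rfl⟩

/-- There is one machine that turns every name `(X, e)` of a non-constant meromorphic function `f` with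
domain `D`, together with every name `p` of an open subset `U` of `D`, into a name of the (open) image
`f '' U`. -/
theorem mainTheorem8 :
    ∃ M : OracleCode,
      ∀ (D : Set RiemannSphere) (f : RiemannSphere → RiemannSphere),
        IsMeromorphicOn f D → IsNonconstantOn f D →
      ∀ (X : Set ℕ) (e : OracleCode), IsFunctionName X e f D →
      ∀ (U : Set RiemannSphere), IsOpen U → U ⊆ D →
      ∀ p : ℕ → ℕ, IsOpenName p U →
        IsOpen (f '' U) ∧
          ∃ q : ℕ → ℕ, M.Computes (tapeJoin (functionNameSeq X e) p) q ∧
            IsOpenName q (f '' U) := by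
  obtain ⟨M, hM⟩ := mainTheorem8_general
  exact ⟨M, fun D f hf hn X e hname U hU hUD p hp =>
    hM f U hU ((hf.isDiscreteOpenOn hn).mono hUD) X e (hname.mono hUD) p hp⟩
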